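/- Let $k,n\ge 1$. Let $\mathfrak{gl}_M$ (with standard basis $e_{ij}^{(M)}$) act on $V_\bullet^{(M)}=\mathbb C[x_1,\dots,x_M]=\bigoplus_{l\ge 0}V_l^{(M)}$ by $e_{ij}^{(M)}\mapsto x_i\,\partial/\partial x_j$, where $V_l^{(M)}$ is the space of homogeneous polynomials of degree $l$. The rational $R$-matrix $R^{(M)}(t)$ is the operator on $V_\bullet^{(M)}\otimes V_\bullet^{(M)}$, depending rationally on $t$ with poles only at integers, which preserves every $V_l^{(M)}\otimes V_m^{(M)}$, commutes with all $g\otimes 1+1\otimes g$, $g\in\mathfrak{gl}_M$, satisfies $$R^{(M)}(t)\Bigl(t\,e_{ij}\otimes 1+\sum_{c=1}^M e_{ic}\otimes e_{cj}\Bigr)=\Bigl(t\,e_{ij}\otimes 1+\sum_{c=1}^M e_{cj}\otimes e_{ic}\Bigr)R^{(M)}(t)\qquad(1\le i,j\le M),$$ and fixes $x_1^l\otimes x_1^m$ for all $l,m\ge 0$. Let $P_{kn}=\mathbb C[x_{ai}\,:\,1\le a\le k,\ 1\le i\le n]$, with the commuting actions $e_{ab}^{(k)}\mapsto\sum_{i=1}^n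 x_{ai}\,\partial/\partial x_{bi}$ of $\mathfrak{gl}_k$ and $e_{ij}^{(n)}\mapsto\sum_{a=1}^k x_{ai}\,\partial/\partial x_{aj}$ of $\mathfrak{gl}_n$. Identify $P_{kn}$ with $(V_\bullet^{(k)})^{\otimes n}$ by $p_1\otimes\dots\otimes p_n\mapsto\prod_{i=1}^n p_i(x_{1i},\dots,x_{ki})$ and with $(V_\bullet^{(n)})^{\otimes k}$ by $p_1\otimes\dots\otimes p_k\mapsto\prod_{a=1}^k p_a(x_{a1},\dots,x_{an})$. For $i\ne j$ let $R^{(k)}_{ij}(t)$ be the operator on $P_{kn}$ acting as $R^{(k)}(t)$ on the $i$-th and $j$-th factors of $(V_\bullet^{(k)})^{\otimes n}$; for $a\ne b$ let $R^{(n)}_{ab}(t)$ be the operator on $P_{kn}$ acting as $R^{(n)}(t)$ on the $a$-th and $b$-th factors of $(V_\bullet^{(n)})^{\otimes k}$. For $a\neq b$ set $$B^{(k)}_{ab}(t)=1+\sum_{s=1}^\infty (e^{(k)}_{ba})^s(e^{(k)}_{ab})^s\prod_{j=1}^s\frac1{j\,(t-e^{(k)}_{aa}+e^{(k)}_{bb}-j)},\qquad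 C^{(k)}_{ab}(t)=\frac{\Gamma(t+1)\,\Gamma(t-e^{(k)}_{aa}+e^{(k)}_{bb})}{\Gamma(t-e^{(k)}_{aa})\,\Gamma(t+e^{(k)}_{bb}+1)},$$ operators on $P_{kn}$ (the sum is finite on every polynomial, and functions of $e_{aa},e_{bb}$ act on weight subspaces by the corresponding scalars), and define $B^{(n)}_{ij}(t)$, $C^{(n)}_{ij}(t)$ for $i\ne j$ in the same way from the $\mathfrak{gl}_n$-action. Then the $R$-matrices $R^{(n)}(t)$ and $R^{(k)}(t)$ exist and, for every $t\in\mathbb C\setminus\mathbb Z$, are uniquely determined by the conditions above, and for all $a\ne b$ in $\{1,\dots,k\}$, all $i\ne j$ in $\{1,\dots,n\}$ and all $t\in\mathbb C\setminus\mathbb Z$ (hence as rational functions of $t$), as operators on $P_{kn}$, $$B^{(k)}_{ab}(t)\,C^{(k)}_{ab}(t)=R^{(n)}_{ab}(t),\qquad R^{(k)}_{ij}(t)=B^{(n)}_{ij}(t)\,C^{(n)}_{ij}(t).$$ -/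

import Mathlib

open scoped TensorProduct

noncomputable section

namespace GLDuality

/-! ### The module `V_• = ℂ[x_1, …, x_M]` of `gl_M` and rational R-matrices -/

/-- The space `V_•^{(M)} = ℂ[x_1, …, x_M]`. -/
abbrev V (M : ℕ) : Type := MvPolynomial (Fin M) ℂ

/-- The first order differential operator `x_u ∂/∂x_v` on a polynomial ring. -/
def xd {γ : Type} (u v : γ) : Module.End ℂ (MvPolynomial γ ℂ) :=
  LinearMap.mulLeft ℂ (MvPolynomial.X u) ∘ₗ (MvPolynomial.pderiv v).toLinearMap

/-- The action of the basis element `e_{ij}` of `gl_M` on `V_•^{(M)}`, `e_{ij} ↦ x_i ∂_j`. -/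
def e (M : ℕ) (i j : Fin M) : Module.End ℂ (V M) := xd i j

/-- The submodule `V_l ⊗ V_m` of `V_• ⊗ V_•`, where `V_l` is spanned by the homogeneous polynomials
of degree `l`. -/
def VV (M l m : ℕ) : Submodule ℂ (V M ⊗[ℂ] V M) :=
  Submodule.map₂ (TensorProduct.mk ℂ (V M) (V M))
    (MvPolynomial.homogeneousSubmodule (Fin M) ℂ l)
    (MvPolynomial.homogeneousSubmodule (Fin M) ℂ m)

/-- `T` is the value at `t` of the rational R-matrix of `gl_M` on `V_• ⊗ V_•`, i.e. `T` is the
direct sum of its restrictions to the submodules `V_l ⊗ V_m` (`preserves`), and each of these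
restrictions is `gl_M`-invariant, satisfies the defining commutation relations, and fixes the tensor
product `x_1^l ⊗ x_1^m` of the highest weight vectors. (All operators in `invariant` and `comm`
preserve every `V_l ⊗ V_m`, so these two relations on `V_• ⊗ V_•` say the same as the relations for
all the restrictions.) -/
structure IsRMatrixAt (M : ℕ) [NeZero M] (t : ℂ) (T : Module.End ℂ (V M ⊗[ℂ] V M)) : Prop where
  preserves : ∀ l m : ℕ, ∀ u ∈ VV M l m, T u ∈ VV M l m
  invariant : ∀ i j : Fin M,
    T * (TensorProduct.map (e M i j) 1 + TensorProduct.map 1 (e M i j)) =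
      (TensorProduct.map (e M i j) 1 + TensorProduct.map 1 (e M i j)) * T
  comm : ∀ i j : Fin M,
    T * (t • TensorProduct.map (e M i j) 1 + ∑ c, TensorProduct.map (e M i c) (e M c j)) =
      (t • TensorProduct.map (e M i j) 1 + ∑ c, TensorProduct.map (e M c j) (e M i c)) * T
  normalized : ∀ l m : ℕ,
    T ((MvPolynomial.X 0 ^ l) ⊗ₜ[ℂ] (MvPolynomial.X 0 ^ m)) =
      (MvPolynomial.X 0 ^ l) ⊗ₜ[ℂ] (MvPolynomial.X 0 ^ m)

/-- `R` is the rational R-matrix of `gl_M` on `V_• ⊗ V_•`: a rational operator-valued function of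
`t` whose values satisfy the defining relations. All poles are at integers, so the function is
considered on `ℂ ∖ ℤ`; the values of `R` at integers are irrelevant. Rationality says that for every
vector `u` the function `R(t) u` is a vector-valued polynomial divided by a nonzero scalar
polynomial. -/
structure IsRMatrix (M : ℕ) [NeZero M] (R : ℂ → Module.End ℂ (V M ⊗[ℂ] V M)) : Prop where
  rational : ∀ u : V M ⊗[ℂ] V M, ∃ q : Polynomial ℂ, q ≠ 0 ∧
    ∃ (N : ℕ) (w : ℕ → V M ⊗[ℂ] V M), ∀ t : ℂ, t ∉ Set.range ((↑) : ℤ → ℂ) →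
      q.eval t • R t u = ∑ i ∈ Finset.range N, t ^ i • w i
  at_value : ∀ t : ℂ, t ∉ Set.range ((↑) : ℤ → ℂ) → IsRMatrixAt M t (R t)

open Classical in
/-- The rational R-matrix `R_{V_• V_•}(t)` of `gl_M`. Its defining conditions determine it uniquely
for `t ∉ ℤ`. -/
def rMatrix (M : ℕ) [NeZero M] : ℂ → Module.End ℂ (V M ⊗[ℂ] V M) :=
  if h : ∃ R, IsRMatrix M R then h.choose else 0

/-! ### Operators acting in two factors of a tensor power -/

section TensorPower

variable {ι : Type} [DecidableEq ι] {W : Type} [AddCommGroup W] [Module ℂ W]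

/-- Given a family `p` of vectors, the linear map sending `u ⊗ v` to `⊗ₗ p_l` with the `i`-th
factor replaced by `u` and the `j`-th one by `v`. -/
def place {i j : ι} (hij : i ≠ j) (p : ι → W) : W ⊗[ℂ] W →ₗ[ℂ] ⨂[ℂ] _ : ι, W :=
  TensorProduct.lift (LinearMap.mk₂ ℂ
    (fun u v => PiTensorProduct.tprod ℂ (Function.update (Function.update p i u) j v))
    (fun u u' v => by
      simp only [Function.update_comm hij]
      exact MultilinearMap.map_update_add _ _ _ _ _)
    (fun c u v => by
      simp only [Function.update_comm hij]
      exact MultilinearMap.map_update_smul _ _ _ _ _)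
    (fun u v v' => MultilinearMap.map_update_add _ _ _ _ _)
    (fun c u v => MultilinearMap.map_update_smul _ _ _ _ _))

theorem place_tmul {i j : ι} (hij : i ≠ j) (p : ι → W) (u v : W) :
    place hij p (u ⊗ₜ v) =
      PiTensorProduct.tprod ℂ (Function.update (Function.update p i u) j v) := rfl

theorem place_update_left {i j : ι} (hij : i ≠ j) (p : ι → W) (x : W) :
    place hij (Function.update p i x) = place hij p := by
  apply TensorProduct.ext'
  intro u v
  simp [place_tmul]

theorem place_update_right {i j : ι} (hij : i ≠ j) (p : ι → W) (x : W) :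
    place hij (Function.update p j x) = place hij p := by
  apply TensorProduct.ext'
  intro u v
  rw [place_tmul, place_tmul, Function.update_comm hij, Function.update_idem,
    Function.update_comm hij]

theorem place_update_add {i j : ι} (hij : i ≠ j) (p : ι → W) (l : ι) (hi : l ≠ i) (hj : l ≠ j)
    (x y : W) : place hij (Function.update p l (x + y)) =
      place hij (Function.update p l x) + place hij (Function.update p l y) := by
  apply TensorProduct.ext'
  intro u v
  simp only [LinearMap.add_apply, place_tmul, Function.update_comm hi, Function.update_comm hj]
  exact MultilinearMap.map_update_add _ _ _ _ _

theorem place_update_smul {i j : ι} (hij : i ≠ j) (p : ι → W) (l : ι) (hi : l ≠ i) (hj : l ≠ j)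
    (c : ℂ) (x : W) : place hij (Function.update p l (c • x)) =
      c • place hij (Function.update p l x) := by
  apply TensorProduct.ext'
  intro u v
  simp only [LinearMap.smul_apply, place_tmul, Function.update_comm hi, Function.update_comm hj]
  exact MultilinearMap.map_update_smul _ _ _ _ _

/-- The operator `T^{(ij)}` on `W^{⊗ ι}` acting as `T` on the `i`-th and `j`-th factors (the first
factor of `W ⊗ W` being put in place `i`, the second one in place `j`) and as the identity on all
the other factors. -/
def pairAct {i j : ι} (hij : i ≠ j) (T : Module.End ℂ (W ⊗[ℂ] W)) :
    Module.End ℂ (⨂[ℂ] _ : ι, W) :=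
  PiTensorProduct.lift (MultilinearMap.mk' (fun p : ι → W => place hij p (T (p i ⊗ₜ[ℂ] p j)))
    (by
      intro p l x y
      by_cases hi : l = i
      · subst hi
        simp [place_update_left, hij.symm, TensorProduct.add_tmul]
      by_cases hj : l = j
      · subst hj
        simp [place_update_right, hij, TensorProduct.tmul_add]
      rw [place_update_add hij p l hi hj]
      simp [Ne.symm hi, Ne.symm hj])
    (by
      intro p l c x
      by_cases hi : l = i
      · subst hi
        simp [place_update_left, hij.symm, ← TensorProduct.smul_tmul']
      by_cases hj : l = j
      · subst hj
        simp [place_update_right, hij, TensorProduct.tmul_smul]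
      rw [place_update_smul hij p l hi hj]
      simp [Ne.symm hi, Ne.symm hj]))

theorem pairAct_tprod {i j : ι} (hij : i ≠ j) (T : Module.End ℂ (W ⊗[ℂ] W)) (p : ι → W) :
    pairAct hij T (PiTensorProduct.tprod ℂ p) = place hij p (T (p i ⊗ₜ[ℂ] p j)) := by
  simp [pairAct]

end TensorPower

/-! ### The space `P_{kn}` and its two descriptions as a tensor power -/

/-- The polynomial ring `P_{kn} = ℂ[x_{ai}]`, `a = 1, …, k`, `i = 1, …, n`. -/
abbrev P (k n : ℕ) : Type := MvPolynomial (Fin k × Fin n) ℂ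

section ProdMap

variable {α β γ : Type} [Fintype α]

/-- The linear map `⊗_i p_i ↦ ∏_i p_i(x_{φ(i, ·)})`. -/
def prodMap (φ : α × β ≃ γ) :
    (⨂[ℂ] _ : α, MvPolynomial β ℂ) →ₗ[ℂ] MvPolynomial γ ℂ :=
  PiTensorProduct.lift ((MultilinearMap.mkPiAlgebra ℂ α (MvPolynomial γ ℂ)).compLinearMap
    fun i => (MvPolynomial.rename fun x => φ (i, x)).toLinearMap)

theorem prodMap_tprod (φ : α × β ≃ γ) (p : α → MvPolynomial β ℂ) :
    prodMap φ (PiTensorProduct.tprod ℂ p) =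
      ∏ i, MvPolynomial.rename (fun x => φ (i, x)) (p i) := by
  simp [prodMap]

theorem prodMap_bijective (φ : α × β ≃ γ) : Function.Bijective (prodMap φ) := by
  let σ : (α → (β →₀ ℕ)) ≃ (γ →₀ ℕ) :=
    (Finsupp.equivFunOnFinite.symm.trans Finsupp.curryEquiv.symm).trans (Finsupp.equivCongrLeft φ)
  have hσ : ∀ d : α → (β →₀ ℕ), ∑ i, Finsupp.mapDomain (fun x => φ (i, x)) (d i) = σ d := by
    intro d
    ext c
    obtain ⟨⟨i, x⟩, rfl⟩ := φ.surjective c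
    have h1 : σ d (φ (i, x)) = d i x := by
      simp [σ, Finsupp.curryEquiv, Finsupp.uncurry_apply]
    rw [h1, Finsupp.finsetSum_apply, Finset.sum_eq_single i]
    · exact Finsupp.mapDomain_apply (f := fun x => φ (i, x))
        (fun y z h => by simpa using h) (d i) x
    · intro j _ hj
      apply Finsupp.mapDomain_of_notMem_range
      rintro ⟨y, hy⟩
      exact hj (by simpa using congrArg Prod.fst (φ.injective hy))
    · simp
  let E := (Basis.piTensorProduct (fun _ : α => MvPolynomial.basisMonomials β ℂ)).equiv
    (MvPolynomial.basisMonomials γ ℂ) σ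
  have hE : prodMap φ = E.toLinearMap := by
    apply (Basis.piTensorProduct (fun _ : α => MvPolynomial.basisMonomials β ℂ)).ext
    intro d
    simp only [E, LinearEquiv.coe_coe, Module.Basis.equiv_apply]
    rw [Basis.piTensorProduct_apply, prodMap_tprod]
    simp only [MvPolynomial.coe_basisMonomials, MvPolynomial.rename_monomial, ← hσ]
    exact (MvPolynomial.monomial_sum_one _ _).symm
  rw [hE]
  exact E.bijective

end ProdMap

/-- The isomorphism `(V_•^{(k)})^{⊗ n} → P_{kn}`,
`p_1 ⊗ … ⊗ p_n ↦ ∏_i p_i(x_{1i}, …, x_{ki})`. -/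
def kIso (k n : ℕ) : (⨂[ℂ] _ : Fin n, V k) ≃ₗ[ℂ] P k n :=
  LinearEquiv.ofBijective (prodMap (Equiv.prodComm (Fin n) (Fin k))) (prodMap_bijective _)

theorem kIso_tprod (k n : ℕ) (p : Fin n → V k) :
    kIso k n (PiTensorProduct.tprod ℂ p) =
      ∏ i, MvPolynomial.rename (fun a => (a, i)) (p i) :=
  prodMap_tprod _ p

/-- The isomorphism `(V_•^{(n)})^{⊗ k} → P_{kn}`,
`p_1 ⊗ … ⊗ p_k ↦ ∏_a p_a(x_{a1}, …, x_{an})`. -/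
def nIso (k n : ℕ) : (⨂[ℂ] _ : Fin k, V n) ≃ₗ[ℂ] P k n :=
  LinearEquiv.ofBijective (prodMap (Equiv.refl (Fin k × Fin n))) (prodMap_bijective _)

theorem nIso_tprod (k n : ℕ) (p : Fin k → V n) :
    nIso k n (PiTensorProduct.tprod ℂ p) =
      ∏ a, MvPolynomial.rename (fun i => (a, i)) (p a) :=
  prodMap_tprod _ p

/-- The operator `R_{ij}^{(k)}(t)`: the R-matrix of `gl_k` acting on the `i`-th and `j`-th factors of
`P_{kn} = (V_•^{(k)})^{⊗ n}`. -/
def Rk (k n : ℕ) [NeZero k] {i j : Fin n} (hij : i ≠ j) (t : ℂ) : Module.End ℂ (P k n) :=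
  (kIso k n).conj (pairAct hij (rMatrix k t))

/-- The operator `R_{ab}^{(n)}(t)`: the R-matrix of `gl_n` acting on the `a`-th and `b`-th factors of
`P_{kn} = (V_•^{(n)})^{⊗ k}`. -/
def Rn (k n : ℕ) [NeZero n] {a b : Fin k} (hab : a ≠ b) (t : ℂ) : Module.End ℂ (P k n) :=
  (nIso k n).conj (pairAct hab (rMatrix n t))

/-! ### The actions of `gl_k` and `gl_n` on `P_{kn}` -/

/-- The action of `e_{ab}^{(k)}` on `P_{kn}`: `∑_i x_{ai} ∂_{bi}`. -/
def ek (k n : ℕ) (a b : Fin k) : Module.End ℂ (P k n) := ∑ i : Fin n, xd (a, i) (b, i)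

/-- The action of `e_{ij}^{(n)}` on `P_{kn}`: `∑_a x_{ai} ∂_{aj}`. -/
def en (k n : ℕ) (i j : Fin n) : Module.End ℂ (P k n) := ∑ a : Fin k, xd (a, i) (a, j)

/-- The operator multiplying every monomial `x^d` by the number `f d`. -/
def diag {γ : Type} (f : (γ →₀ ℕ) → ℂ) : Module.End ℂ (MvPolynomial γ ℂ) :=
  (MvPolynomial.basisMonomials γ ℂ).constr ℂ fun d => f d • MvPolynomial.monomial d 1

theorem diag_monomial {γ : Type} (f : (γ →₀ ℕ) → ℂ) (d : γ →₀ ℕ) :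
    diag f (MvPolynomial.monomial d 1) = f d • MvPolynomial.monomial d 1 := by
  have h := (MvPolynomial.basisMonomials γ ℂ).constr_basis ℂ
    (fun d => f d • (MvPolynomial.monomial d 1 : MvPolynomial γ ℂ)) d
  simpa [diag] using h

/-- For a function `f` of the `gl_k` weight `(m_1, …, m_k)`, the operator
`f(e_{11}^{(k)}, …, e_{kk}^{(k)})` on `P_{kn}`, which acts on the weight subspace of weight `m` as
multiplication by `f m`. -/
def funk (k n : ℕ) (f : (Fin k → ℂ) → ℂ) : Module.End ℂ (P k n) :=
  diag fun d => f fun a => ∑ i : Fin n, (d (a, i) : ℂ)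

/-- For a function `f` of the `gl_n` weight `(l_1, …, l_n)`, the operator
`f(e_{11}^{(n)}, …, e_{nn}^{(n)})` on `P_{kn}`, which acts on the weight subspace of weight `l` as
multiplication by `f l`. -/
def funn (k n : ℕ) (f : (Fin n → ℂ) → ℂ) : Module.End ℂ (P k n) :=
  diag fun d => f fun i => ∑ a : Fin k, (d (a, i) : ℂ)

theorem xd_monomial {γ : Type} (u v : γ) (d : γ →₀ ℕ) (c : ℂ) :
    xd u v (MvPolynomial.monomial d c) =
      MvPolynomial.monomial (Finsupp.single u 1 + (d - Finsupp.single v 1)) (c * d v) := by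
  simp [xd, MvPolynomial.pderiv_monomial, MvPolynomial.X, MvPolynomial.monomial_mul]

theorem xd_self_monomial {γ : Type} (u : γ) (d : γ →₀ ℕ) :
    xd u u (MvPolynomial.monomial d 1) = (d u : ℂ) • MvPolynomial.monomial d 1 := by
  rw [xd_monomial, MvPolynomial.smul_monomial]
  by_cases h : d u = 0
  · simp [h]
  · have h1 : Finsupp.single u 1 + (d - Finsupp.single u 1) = d := by
      rw [add_comm]
      exact tsub_add_cancel_of_le (by simpa using Nat.one_le_iff_ne_zero.mpr h)
    rw [h1]
    simp

/-- The operator `e_{aa}^{(k)}` is the function `m ↦ m_a` of the weight. -/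
theorem ek_diag (k n : ℕ) (a : Fin k) : ek k n a a = funk k n fun m => m a := by
  apply (MvPolynomial.basisMonomials _ ℂ).ext
  intro d
  simp [funk, diag_monomial, ek, xd_self_monomial, Finset.sum_smul]

/-- The operator `e_{ii}^{(n)}` is the function `l ↦ l_i` of the weight. -/
theorem en_diag (k n : ℕ) (i : Fin n) : en k n i i = funn k n fun l => l i := by
  apply (MvPolynomial.basisMonomials _ ℂ).ext
  intro d
  simp [funn, diag_monomial, en, xd_self_monomial, Finset.sum_smul]

/-! ### Local nilpotency of root vectors and locally finite series -/

theorem xd_sum_pow_monomial {γ δ : Type} [Fintype δ] (u v : δ → γ)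
    (huv : ∀ i j, u i ≠ v j) (s : ℕ) : ∀ (d : γ →₀ ℕ) (c : ℂ), ∑ i, d (v i) < s →
      ((∑ i, xd (u i) (v i)) ^ s) (MvPolynomial.monomial d c) = 0 := by
  induction s with
  | zero => intro d c h; omega
  | succ s ih =>
    intro d c h
    rw [pow_succ, Module.End.mul_apply, LinearMap.sum_apply, map_sum]
    apply Finset.sum_eq_zero
    intro i _
    rw [xd_monomial]
    by_cases hd : d (v i) = 0
    · simp [hd]
    · apply ih
      have hlt : ∑ j, (Finsupp.single (u i) 1 + (d - Finsupp.single (v i) 1) : γ →₀ ℕ) (v j)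
          < ∑ j, d (v j) := by
        apply Finset.sum_lt_sum
        · intro j _
          simp [huv]
        · refine ⟨i, Finset.mem_univ _, ?_⟩
          simp [huv]
          omega
      omega

theorem diag_monomial_coeff {γ : Type} (f : (γ →₀ ℕ) → ℂ) (d : γ →₀ ℕ) (c : ℂ) :
    diag f (MvPolynomial.monomial d c) = MvPolynomial.monomial d (c * f d) := by
  have h : (MvPolynomial.monomial d c : MvPolynomial γ ℂ) = c • MvPolynomial.monomial d 1 := by
    simp [MvPolynomial.smul_monomial]
  rw [h, map_smul, diag_monomial]
  simp [MvPolynomial.smul_monomial]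

theorem xd_sum_locally_nilpotent {γ δ : Type} [Fintype δ] (u v : δ → γ)
    (huv : ∀ i j, u i ≠ v j) (p : MvPolynomial γ ℂ) :
    ∃ N, ∀ s, N ≤ s → ∀ f, ((∑ i, xd (u i) (v i)) ^ s) (diag f p) = 0 := by
  induction p using MvPolynomial.induction_on' with
  | monomial d c =>
    refine ⟨∑ i, d (v i) + 1, fun s hs f => ?_⟩
    rw [diag_monomial_coeff]
    exact xd_sum_pow_monomial u v huv s d _ (by omega)
  | add p q hp hq =>
    obtain ⟨N, hN⟩ := hp
    obtain ⟨M, hM⟩ := hq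
    refine ⟨max N M, fun s hs f => ?_⟩
    rw [map_add, map_add, hN s (by omega), hM s (by omega), add_zero]

/-- The sum `∑_{s ≥ 0} T_s` of a sequence of operators such that for every vector `p` only finitely
many of the vectors `T_s p` are nonzero. -/
def series {γ : Type} (T : ℕ → Module.End ℂ (MvPolynomial γ ℂ))
    (hT : ∀ p, ∃ N, ∀ s, N ≤ s → T s p = 0) : Module.End ℂ (MvPolynomial γ ℂ) :=
  have hfin : ∀ p, (Function.support fun s => T s p).Finite := fun p => by
    obtain ⟨N, hN⟩ := hT p
    refine (Set.finite_lt_nat N).subset fun s hs => ?_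
    by_contra h
    exact hs (hN s (not_lt.mp h))
  { toFun := fun p => ∑ᶠ s, T s p
    map_add' := fun p q => by
      simp only [map_add]
      exact finsum_add_distrib (hfin p) (hfin q)
    map_smul' := fun c p => by
      simp only [map_smul, RingHom.id_apply]
      exact (smul_finsum' c (hfin p)).symm }

/-! ### The operators `B(t)` and `C(t)` for `gl_k` and `gl_n` on `P_{kn}` -/

/-- The `s`-th term `e_{ba}^s e_{ab}^s ∏_{j=1}^s 1 / (j (t - e_{aa} + e_{bb} - j))` of the series
`B_{ab}^{(k)}(t)`. -/
def BkTerm (k n : ℕ) (a b : Fin k) (t : ℂ) (s : ℕ) : Module.End ℂ (P k n) :=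
  ek k n b a ^ s * ek k n a b ^ s *
    funk k n fun m => ∏ j ∈ Finset.Icc 1 s, 1 / ((j : ℂ) * (t - m a + m b - j))

theorem BkTerm_finite (k n : ℕ) {a b : Fin k} (hab : a ≠ b) (t : ℂ) (p : P k n) :
    ∃ N, ∀ s, N ≤ s → BkTerm k n a b t s p = 0 := by
  obtain ⟨N, hN⟩ := xd_sum_locally_nilpotent (fun i : Fin n => (a, i)) (fun i => (b, i))
    (fun i j h => hab (congrArg Prod.fst h)) p
  refine ⟨N, fun s hs => ?_⟩
  rw [BkTerm, Module.End.mul_apply, Module.End.mul_apply, funk, ek, ek, hN s hs, map_zero]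

/-- The operator `B_{ab}^{(k)}(t) = 1 + ∑_{s ≥ 1} e_{ba}^s e_{ab}^s
∏_{j=1}^s 1 / (j (t - e_{aa} + e_{bb} - j))` on `P_{kn}`, for the action of `gl_k`. -/
def Bk (k n : ℕ) {a b : Fin k} (hab : a ≠ b) (t : ℂ) : Module.End ℂ (P k n) :=
  1 + series (fun s => BkTerm k n a b t (s + 1)) fun p =>
    (BkTerm_finite k n hab t p).imp fun _ hN s hs => hN (s + 1) (Nat.le_succ_of_le hs)

/-- The operator `C_{ab}^{(k)}(t) = Γ(t+1) Γ(t - e_{aa} + e_{bb}) / (Γ(t - e_{aa}) Γ(t + e_{bb} + 1))`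
on `P_{kn}`, for the action of `gl_k`. -/
def Ck (k n : ℕ) (a b : Fin k) (t : ℂ) : Module.End ℂ (P k n) :=
  funk k n fun m => Complex.Gamma (t + 1) * Complex.Gamma (t - m a + m b) /
    (Complex.Gamma (t - m a) * Complex.Gamma (t + m b + 1))

/-- The `s`-th term `e_{ji}^s e_{ij}^s ∏_{r=1}^s 1 / (r (t - e_{ii} + e_{jj} - r))` of the series
`B_{ij}^{(n)}(t)`. -/
def BnTerm (k n : ℕ) (i j : Fin n) (t : ℂ) (s : ℕ) : Module.End ℂ (P k n) :=
  en k n j i ^ s * en k n i j ^ s *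
    funn k n fun l => ∏ r ∈ Finset.Icc 1 s, 1 / ((r : ℂ) * (t - l i + l j - r))

theorem BnTerm_finite (k n : ℕ) {i j : Fin n} (hij : i ≠ j) (t : ℂ) (p : P k n) :
    ∃ N, ∀ s, N ≤ s → BnTerm k n i j t s p = 0 := by
  obtain ⟨N, hN⟩ := xd_sum_locally_nilpotent (fun a : Fin k => (a, i)) (fun a => (a, j))
    (fun a b h => hij (congrArg Prod.snd h)) p
  refine ⟨N, fun s hs => ?_⟩
  rw [BnTerm, Module.End.mul_apply, Module.End.mul_apply, funn, en, en, hN s hs, map_zero]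

/-- The operator `B_{ij}^{(n)}(t) = 1 + ∑_{s ≥ 1} e_{ji}^s e_{ij}^s
∏_{r=1}^s 1 / (r (t - e_{ii} + e_{jj} - r))` on `P_{kn}`, for the action of `gl_n`. -/
def Bn (k n : ℕ) {i j : Fin n} (hij : i ≠ j) (t : ℂ) : Module.End ℂ (P k n) :=
  1 + series (fun s => BnTerm k n i j t (s + 1)) fun p =>
    (BnTerm_finite k n hij t p).imp fun _ hN s hs => hN (s + 1) (Nat.le_succ_of_le hs)

/-- The operator `C_{ij}^{(n)}(t) = Γ(t+1) Γ(t - e_{ii} + e_{jj}) / (Γ(t - e_{ii}) Γ(t + e_{jj} + 1))`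
on `P_{kn}`, for the action of `gl_n`. -/
def Cn (k n : ℕ) (i j : Fin n) (t : ℂ) : Module.End ℂ (P k n) :=
  funn k n fun l => Complex.Gamma (t + 1) * Complex.Gamma (t - l i + l j) /
    (Complex.Gamma (t - l i) * Complex.Gamma (t + l j + 1))

end GLDuality

end

noncomputable section

namespace GLDuality

/-! ### Identities for `sl_2`-triples acting on a module -/

section SlTwo

variable {W : Type*} [AddCommGroup W] [Module ℂ W] {E F H : Module.End ℂ W}

/-! On `V_• ⊗ V_•` the diagonal `gl_M` commutes with a second algebra, `gl_2`, generated by the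
contractions E = ∑ x_c ⊗ ∂_c and F = ∑ ∂_c ⊗ x_c together with the two Euler operators, which act on
V_l ⊗ V_m by l and m. Hence B(t) C(t), written in terms of this `gl_2`, makes sense on `V_• ⊗ V_•`
itself. This is the operator `rOp`; the theorem amounts to showing that `rOp` satisfies the
conditions defining the R-matrix and that these conditions have only one solution.

Invariance holds because E and F commute with the diagonal action. For the second relation put Y =
x_i ⊗ ∂_j, Z = ∂_j ⊗ x_i and Q = t e_ij ⊗ 1 - 1 ⊗ e_ij. Reordering factors turns the relation into R
(Q + F Y) = (Q + Z E) R. For R = ∑ c_s F^s E^s on a fixed V_l ⊗ V_m, the difference of the two sides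
telescopes exactly when the c_s obey the two-term recurrence that defines the coefficients of B(t)
(`intertwining_defect`), and the remaining boundary term dies because E is locally nilpotent. The
scalar C(t) enters only through the normalization: on x_1^l ⊗ x_1^m the series B(t) sums by the
Chu–Vandermonde identity to the inverse of C(t) (`sum_bCoeff`).

Uniqueness is a cyclicity statement: two solutions agree on a subspace stable under both families of
operators and containing all x_1^l ⊗ x_1^m, and for non-integral t such a subspace is everything
(`eq_top_of_yangian_stable`).

Finally, `prodMap` carries multiplications and derivatives in two tensor factors to those in the
corresponding rows or columns of variables. So E and F become root vectors of the other general
linear algebra on `P k n`, and `rOp` becomes B C there (`prodMap_pairAct_rOp`). -/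

theorem weight_raise {h : ℂ} {u : W} (hHE : H * E = E * H + (2 : ℂ) • E) (hu : H u = h • u)
    (s : ℕ) : H ((E ^ s) u) = (h + 2 * s) • (E ^ s) u := by
  induction s with
  | zero => simp [hu]
  | succ s ih =>
    have h1 := LinearMap.congr_fun hHE ((E ^ s) u)
    simp only [Module.End.mul_apply, LinearMap.add_apply, LinearMap.smul_apply, ih,
      map_smul] at h1
    rw [pow_succ', Module.End.mul_apply, h1]
    push_cast
    module

theorem weight_lower {h : ℂ} {u : W} (hHF : H * F = F * H - (2 : ℂ) • F) (hu : H u = h • u)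
    (s : ℕ) : H ((F ^ s) u) = (h - 2 * s) • (F ^ s) u := by
  induction s with
  | zero => simp [hu]
  | succ s ih =>
    have h1 := LinearMap.congr_fun hHF ((F ^ s) u)
    simp only [Module.End.mul_apply, LinearMap.sub_apply, LinearMap.smul_apply, ih,
      map_smul] at h1
    rw [pow_succ', Module.End.mul_apply, h1]
    push_cast
    module

/-- Moving F past each E produces one H, evaluated at the weights h, h + 2, ..., h + 2s, whose sum
is (s + 1)(h + s). In `raise_lower_pow` the weights descend instead, giving (s + 1)(h - s). -/
theorem raise_pow_lower {h : ℂ} {u : W} (hEF : E * F = F * E + H)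
    (hHE : H * E = E * H + (2 : ℂ) • E) (hu : H u = h • u) (s : ℕ) :
    (E ^ (s + 1)) (F u) = F ((E ^ (s + 1)) u) + ((s + 1 : ℂ) * (h + s)) • (E ^ s) u := by
  induction s with
  | zero =>
    have h1 := LinearMap.congr_fun hEF u
    simp only [Module.End.mul_apply, LinearMap.add_apply, hu] at h1
    simp [h1]
  | succ s ih =>
    have h1 := LinearMap.congr_fun hEF ((E ^ (s + 1)) u)
    simp only [Module.End.mul_apply, LinearMap.add_apply, weight_raise hHE hu] at h1
    have h2 : ∀ v, E ((E ^ s) v) = (E ^ (s + 1)) v := fun v => by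
      rw [pow_succ', Module.End.mul_apply]
    rw [pow_succ' E (s + 1), Module.End.mul_apply, Module.End.mul_apply, ih, map_add, map_smul, h1,
      h2]
    push_cast
    module

theorem raise_lower_pow {h : ℂ} {u : W} (hEF : E * F = F * E + H)
    (hHF : H * F = F * H - (2 : ℂ) • F) (hu : H u = h • u) (s : ℕ) :
    E ((F ^ (s + 1)) u) = (F ^ (s + 1)) (E u) + ((s + 1 : ℂ) * (h - s)) • (F ^ s) u := by
  induction s with
  | zero =>
    have h1 := LinearMap.congr_fun hEF u
    simp only [Module.End.mul_apply, LinearMap.add_apply, hu] at h1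
    simp [h1]
  | succ s ih =>
    have h1 := LinearMap.congr_fun hEF ((F ^ (s + 1)) u)
    simp only [Module.End.mul_apply, LinearMap.add_apply, weight_lower hHF hu] at h1
    have h2 : ∀ v, F ((F ^ s) v) = (F ^ (s + 1)) v := fun v => by
      rw [pow_succ', Module.End.mul_apply]
    rw [pow_succ' F (s + 1), Module.End.mul_apply, h1, ih, map_add, map_smul, h2,
      Module.End.mul_apply]
    push_cast
    module

/-- The commutator of E with Q is a multiple of Y, which commutes with E, so the Leibniz rule stops
at first order. `comm_lower_pow` is the mirror statement for F and Z. -/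
theorem raise_pow_comm {Q Y : Module.End ℂ W} {τ : ℂ} (hEQ : E * Q = Q * E - τ • Y)
    (hEY : E * Y = Y * E) (u : W) (s : ℕ) :
    (E ^ (s + 1)) (Q u) = Q ((E ^ (s + 1)) u) - ((s + 1 : ℂ) * τ) • Y ((E ^ s) u) := by
  have hY : ∀ v, E (Y v) = Y (E v) := fun v => LinearMap.congr_fun hEY v
  have hQ : ∀ v, E (Q v) = Q (E v) - τ • Y v := fun v => LinearMap.congr_fun hEQ v
  induction s with
  | zero => simp [hQ]
  | succ s ih =>
    have h2 : ∀ v, E ((E ^ s) v) = (E ^ (s + 1)) v := fun v => by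
      rw [pow_succ', Module.End.mul_apply]
    rw [pow_succ' E (s + 1), Module.End.mul_apply, Module.End.mul_apply, ih, map_sub, map_smul, hQ,
      hY, h2]
    push_cast
    module

theorem comm_lower_pow {Q Z : Module.End ℂ W} {τ : ℂ} (hFQ : F * Q = Q * F + τ • Z)
    (hFZ : F * Z = Z * F) (u : W) (s : ℕ) :
    Q ((F ^ (s + 1)) u) = (F ^ (s + 1)) (Q u) - ((s + 1 : ℂ) * τ) • (F ^ s) (Z u) := by
  have hQ : ∀ v, Q (F v) = F (Q v) - τ • Z v := fun v => by
    have := LinearMap.congr_fun hFQ v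
    simp only [Module.End.mul_apply, LinearMap.add_apply, LinearMap.smul_apply] at this
    rw [this]; module
  have hZ : ∀ s, Z ((F ^ s) u) = (F ^ s) (Z u) := fun s =>
    LinearMap.congr_fun (((show Commute F Z from hFZ).pow_left s).eq.symm) u
  induction s with
  | zero => simp [hQ]
  | succ s ih =>
    rw [pow_succ' F (s + 1), Module.End.mul_apply, hQ, ih, hZ, map_sub, map_smul,
      pow_succ' F s, Module.End.mul_apply, Module.End.mul_apply, Module.End.mul_apply]
    push_cast
    module

/-- The truncated defect of the intertwining relation
`(∑ c_s F^s E^s) (Q + F Y) = (Q + Z E) (∑ c_s F^s E^s)`. -/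
theorem intertwining_defect {Q Y Z : Module.End ℂ W} {t h : ℂ} {u : W}
    (hEF : E * F = F * E + H) (hHE : H * E = E * H + (2 : ℂ) • E)
    (hHF : H * F = F * H - (2 : ℂ) • F)
    (hEQ : E * Q = Q * E - (t + 1) • Y) (hEY : E * Y = Y * E)
    (hFQ : F * Q = Q * F + (t + 1) • Z) (hFZ : F * Z = Z * F)
    (hu : H u = h • u) (hYu : H (Y u) = (h + 2) • Y u)
    (c : ℕ → ℂ) (hc0 : c 0 = 1)
    (hc : ∀ s : ℕ, c (s + 1) * ((s + 1) * (h + s + 1 - t)) = -c s) (N : ℕ) :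
    ∑ s ∈ Finset.range (N + 1), c s • ((F ^ s) ((E ^ s) (Q u + F (Y u)))
      - (Q ((F ^ s) ((E ^ s) u)) + Z (E ((F ^ s) ((E ^ s) u))))) =
    c N • ((F ^ (N + 1)) (Y ((E ^ N) u)) - (F ^ N) (Z ((E ^ (N + 1)) u))) := by
  have hYE : ∀ s, (E ^ s) (Y u) = Y ((E ^ s) u) := fun s =>
    LinearMap.congr_fun (((show Commute E Y from hEY).pow_left s).eq) u
  have hZF : ∀ s v, Z ((F ^ s) v) = (F ^ s) (Z v) := fun s v =>
    LinearMap.congr_fun (((show Commute F Z from hFZ).pow_left s).eq.symm) v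
  induction N with
  | zero => simp [hc0]
  | succ N ih =>
    rw [Finset.sum_range_succ, ih]
    -- Two weights enter: E^(N+1) is moved past F on Y u, of weight h + 2, and E past F^(N+1) on
    -- E^(N+1) u, of weight h + 2(N + 1). Both give the factor (N + 1)(h + N + 2), and the
    -- commutators with Q reduce it to (N + 1)(h + N + 1 - t).
    have hw := weight_raise hHE hu (N + 1)
    rw [map_add, map_add, raise_pow_comm hEQ hEY, raise_pow_lower hEF hHE hYu, hYE, hYE,
      comm_lower_pow hFQ hFZ, raise_lower_pow hEF hHF hw]
    have h1 : ∀ v, (F ^ (N + 1)) (F v) = (F ^ (N + 1 + 1)) v := fun v => by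
      rw [pow_succ F (N + 1), Module.End.mul_apply]
    have h2 : ∀ v, E ((E ^ (N + 1)) v) = (E ^ (N + 1 + 1)) v := fun v => by
      rw [pow_succ' E (N + 1), Module.End.mul_apply]
    simp only [map_add, map_sub, map_smul, h1, h2, hZF]
    -- With A_s = F^(s+1) Y E^s - F^s Z E^(s+1), term s + 1 equals c_(s+1) (A_(s+1) + (s + 1)(h + s
    -- + 1 - t) A_s) applied to u; the recurrence cancels the second part against c_s A_s.
    have := hc N
    push_cast
    linear_combination (norm := module) this • ((F ^ (N + 1)) (Y ((E ^ N) u)) -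
      (F ^ N) (Z ((E ^ (N + 1)) u)))

end SlTwo

/-! ### The commuting actions of `gl_2` and `gl_M` by differential operators -/

/-- The canonical commutation relations for position operators `p c i` and derivatives `q c i`. -/
structure IsWeyl {A : Type*} [Ring A] {M : ℕ} (p q : Bool → Fin M → A) : Prop where
  pos_comm : ∀ c d i j, p c i * p d j = p d j * p c i
  del_comm : ∀ c d i j, q c i * q d j = q d j * q c i
  del_pos : ∀ c d i j, q d j * p c i = p c i * q d j + if d = c ∧ j = i then 1 else 0

section Weyl

variable {A : Type*} [Ring A] {M : ℕ} {p q : Bool → Fin M → A}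

/-- The operator `x_i ∂_j` with `x_i` in factor `c` and `∂_j` in factor `d`. -/
def op (p q : Bool → Fin M → A) (c d : Bool) (i j : Fin M) : A := p c i * q d j

/-- The action of the `gl_2` commuting with the diagonal `gl_M`. -/
def gl (p q : Bool → Fin M → A) (c d : Bool) : A := ∑ x, op p q c d x x

/-- Normal ordering: the leading part has all positions left of all derivatives. It is symmetric in
the two operators, so only the contraction terms survive in `IsWeyl.op_comm`. -/
theorem IsWeyl.op_mul (hpq : IsWeyl p q) (c d c' d' : Bool) (i j i' j' : Fin M) :
    op p q c d i j * op p q c' d' i' j' = p c i * p c' i' * q d j * q d' j' +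
      if d = c' ∧ j = i' then op p q c d' i j' else 0 := by
  have h := hpq.del_pos c' d i' j
  calc op p q c d i j * op p q c' d' i' j' = p c i * (q d j * p c' i') * q d' j' := by
        simp only [op, mul_assoc]
    _ = _ := by
        rw [h]
        split_ifs <;> simp [op, mul_add, add_mul, mul_assoc]

theorem IsWeyl.op_comm (hpq : IsWeyl p q) (c d c' d' : Bool) (i j i' j' : Fin M) :
    op p q c d i j * op p q c' d' i' j' = op p q c' d' i' j' * op p q c d i j +
      (if d = c' ∧ j = i' then op p q c d' i j' else 0) -
      (if d' = c ∧ j' = i then op p q c' d i' j else 0) := by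
  rw [hpq.op_mul, hpq.op_mul, hpq.pos_comm c c', mul_assoc _ (q d j), hpq.del_comm d d',
    ← mul_assoc]
  abel

theorem IsWeyl.gl_op (hpq : IsWeyl p q) (c d c' d' : Bool) (i j : Fin M) :
    gl p q c d * op p q c' d' i j = op p q c' d' i j * gl p q c d +
      (if d = c' then op p q c d' i j else 0) - (if d' = c then op p q c' d i j else 0) := by
  simp only [gl, Finset.sum_mul, Finset.mul_sum]
  simp only [hpq.op_comm c d c' d', Finset.sum_add_distrib, Finset.sum_sub_distrib]
  congr 2
  · by_cases h : d = c' <;> simp [h]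
  · by_cases h : d' = c <;> simp [h]

theorem IsWeyl.gl_gl (hpq : IsWeyl p q) (c d c' d' : Bool) :
    gl p q c d * gl p q c' d' = gl p q c' d' * gl p q c d +
      (if d = c' then gl p q c d' else 0) - (if d' = c then gl p q c' d else 0) := by
  conv_lhs => rw [gl.eq_1 p q c' d', Finset.mul_sum]
  simp only [hpq.gl_op, Finset.sum_add_distrib, Finset.sum_sub_distrib, ← Finset.sum_mul]
  congr 2
  · by_cases h : d = c' <;> simp [h, gl]
  · by_cases h : d' = c <;> simp [h, gl]

/-- The two summands of the diagonal action contribute contraction terms that cancel. This is the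
commuting half of the (`gl_2`, `gl_M`) duality. -/
theorem IsWeyl.gl_comm_diagonal (hpq : IsWeyl p q) (c d : Bool) (i j : Fin M) :
    gl p q c d * (op p q false false i j + op p q true true i j) =
      (op p q false false i j + op p q true true i j) * gl p q c d := by
  rw [mul_add, add_mul, hpq.gl_op, hpq.gl_op]
  cases c <;> cases d <;> simp

/-- Both sides have the same normally ordered part. The sum over c is a contraction between the two
factors, so up to a reordering term it factors through a `gl_2` root vector; this and
`IsWeyl.sum_op_right` bring the R-matrix relation to the form Q + F Y against Q + Z E. -/
theorem IsWeyl.sum_op_left (hpq : IsWeyl p q) (i j : Fin M) :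
    ∑ c, op p q false false i c * op p q true true c j =
      gl p q true false * op p q false true i j - op p q true true i j := by
  have h : ∀ c, op p q true false c c * op p q false true i j =
      op p q false false i c * op p q true true c j +
        if c = i then op p q true true c j else 0 := by
    intro c
    rw [hpq.op_mul, hpq.op_mul, hpq.pos_comm true]
    simp
  rw [gl, Finset.sum_mul]
  simp [h, Finset.sum_add_distrib]

theorem IsWeyl.sum_op_right (hpq : IsWeyl p q) (i j : Fin M) :
    ∑ c, op p q false false c j * op p q true true i c =
      op p q true false i j * gl p q false true - op p q true true i j := by
  have h : ∀ c, op p q true false i j * op p q false true c c =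
      op p q false false c j * op p q true true i c +
        if j = c then op p q true true i c else 0 := by
    intro c
    rw [hpq.op_mul, hpq.op_mul, hpq.pos_comm true]
    simp
  rw [gl, Finset.mul_sum]
  simp [h, Finset.sum_add_distrib]

end Weyl

theorem IsWeyl.intertwining {W : Type*} [AddCommGroup W] [Module ℂ W] {M : ℕ}
    {p q : Bool → Fin M → Module.End ℂ W} (hpq : IsWeyl p q) {t l m : ℂ} {u : W}
    (hl : gl p q false false u = l • u) (hm : gl p q true true u = m • u)
    (c : ℕ → ℂ) (hc0 : c 0 = 1)
    (hc : ∀ s : ℕ, c (s + 1) * ((s + 1) * (l - m + s + 1 - t)) = -c s) (N : ℕ)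
    (hN : (gl p q false true ^ N) u = 0) (i j : Fin M) :
    ∑ s ∈ Finset.range (N + 1), c s • (gl p q true false ^ s) ((gl p q false true ^ s)
      (t • op p q false false i j u +
        ∑ x, op p q false false i x (op p q true true x j u))) =
    t • op p q false false i j (∑ s ∈ Finset.range (N + 1),
        c s • (gl p q true false ^ s) ((gl p q false true ^ s) u)) +
      ∑ x, op p q false false x j (op p q true true i x (∑ s ∈ Finset.range (N + 1),
        c s • (gl p q true false ^ s) ((gl p q false true ^ s) u))) := by
  have hL := LinearMap.congr_fun (hpq.sum_op_left i j) u
  have hR := fun v => LinearMap.congr_fun (hpq.sum_op_right i j) v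
  simp only [LinearMap.sum_apply, Module.End.mul_apply, LinearMap.sub_apply] at hL hR
  rw [hL, hR]
  have key := intertwining_defect (E := gl p q false true) (F := gl p q true false)
    (H := gl p q false false - gl p q true true)
    (Q := t • op p q false false i j - op p q true true i j)
    (Y := op p q false true i j) (Z := op p q true false i j) (t := t) (h := l - m) (u := u)
    (by rw [hpq.gl_gl]; simp; abel)
    (by rw [sub_mul, hpq.gl_gl, hpq.gl_gl true true]; simp [mul_sub, two_smul]; abel)
    (by rw [sub_mul, hpq.gl_gl, hpq.gl_gl true true]; simp [mul_sub, two_smul]; abel)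
    (by rw [mul_sub, mul_smul_comm, hpq.gl_op, hpq.gl_op]
        simp [sub_mul, add_smul, smul_sub]; abel)
    (by rw [hpq.gl_op]; simp)
    (by rw [mul_sub, mul_smul_comm, hpq.gl_op, hpq.gl_op]
        simp [sub_mul, add_smul, smul_add]; abel)
    (by rw [hpq.gl_op]; simp)
    (by simp [hl, hm, sub_smul])
    (by
      have h1 := LinearMap.congr_fun (hpq.gl_op false false false true i j) u
      have h2 := LinearMap.congr_fun (hpq.gl_op true true false true i j) u
      simp at h1 h2
      rw [LinearMap.sub_apply, h1, h2, hl, hm, map_smul, map_smul]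
      module)
    c hc0 hc N
  -- The boundary term of the telescoping sum involves only E^N u and E^(N+1) u.
  have hN' : (gl p q false true ^ (N + 1)) u = 0 := by
    rw [pow_succ', Module.End.mul_apply, hN, map_zero]
  rw [hN, hN'] at key
  simp only [map_zero, sub_zero, smul_zero, smul_sub, Finset.sum_sub_distrib] at key
  rw [sub_eq_zero] at key
  convert key using 1
  · refine Finset.sum_congr rfl fun s _ => ?_
    simp only [LinearMap.sub_apply, LinearMap.smul_apply, map_add, map_sub, map_smul]
    module
  · simp only [map_sum, map_smul, Finset.smul_sum, ← Finset.sum_sub_distrib,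
      ← Finset.sum_add_distrib, LinearMap.sub_apply, LinearMap.smul_apply]
    refine Finset.sum_congr rfl fun s _ => ?_
    module

/-! ### Differential operators on `V_• ⊗ V_•` -/

theorem pderiv_pderiv_comm {γ : Type} (i j : γ) (p : MvPolynomial γ ℂ) :
    MvPolynomial.pderiv i (MvPolynomial.pderiv j p) =
      MvPolynomial.pderiv j (MvPolynomial.pderiv i p) := by
  classical
  induction p using MvPolynomial.induction_on with
  | C a => simp
  | add p q hp hq => simp [hp, hq]
  | mul_X p x hp =>
    simp only [MvPolynomial.pderiv_mul, map_add, MvPolynomial.pderiv_X, hp, Pi.single_apply]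
    split_ifs <;> simp
    ring

theorem pderiv_mul_pderiv {γ : Type} (i j : γ) :
    (MvPolynomial.pderiv i).toLinearMap * (MvPolynomial.pderiv j).toLinearMap =
      ((MvPolynomial.pderiv j).toLinearMap * (MvPolynomial.pderiv i).toLinearMap :
        Module.End ℂ (MvPolynomial γ ℂ)) := by
  apply LinearMap.ext
  intro p
  rw [Module.End.mul_apply, Module.End.mul_apply]
  exact pderiv_pderiv_comm i j p

theorem pderiv_eq_zero_of_isHomogeneous_zero {γ : Type} {p : MvPolynomial γ ℂ}
    (hp : p.IsHomogeneous 0) (i : γ) : MvPolynomial.pderiv i p = 0 := by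
  rw [MvPolynomial.totalDegree_eq_zero_iff_eq_C.mp (Nat.le_zero.mp hp.totalDegree_le),
    MvPolynomial.pderiv_C]

section Operators

variable {M : ℕ}

/-- The operator `S` acting on the first (`false`) or second (`true`) factor of `V_• ⊗ V_•`. -/
def fac (c : Bool) (S : Module.End ℂ (V M)) : Module.End ℂ (V M ⊗[ℂ] V M) :=
  if c then TensorProduct.map 1 S else TensorProduct.map S 1

theorem fac_mul (c : Bool) (S T : Module.End ℂ (V M)) : fac c S * fac c T = fac c (S * T) := by
  cases c <;> simp [fac, ← TensorProduct.map_mul]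

theorem fac_comm {c d : Bool} (h : c ≠ d) (S T : Module.End ℂ (V M)) :
    fac c S * fac d T = fac d T * fac c S := by
  cases c <;> cases d <;> simp_all [fac, ← TensorProduct.map_mul]

/-- Multiplication by the `i`-th variable of factor `c`. -/
def pos (c : Bool) (i : Fin M) : Module.End ℂ (V M ⊗[ℂ] V M) :=
  fac c (LinearMap.mulLeft ℂ (MvPolynomial.X i))

/-- Differentiation in the `i`-th variable of factor `c`. -/
def del (c : Bool) (i : Fin M) : Module.End ℂ (V M ⊗[ℂ] V M) :=
  fac c (MvPolynomial.pderiv i).toLinearMap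

theorem fac_pderiv_mulLeft (d : Bool) (i j : Fin M) :
    fac d ((MvPolynomial.pderiv j).toLinearMap * LinearMap.mulLeft ℂ (MvPolynomial.X i)) =
      fac d (LinearMap.mulLeft ℂ (MvPolynomial.X i) * (MvPolynomial.pderiv j).toLinearMap) +
        if j = i then 1 else 0 := by
  by_cases h : j = i
  · subst h
    have h1 : (MvPolynomial.pderiv j).toLinearMap * LinearMap.mulLeft ℂ (MvPolynomial.X j) =
        LinearMap.mulLeft ℂ (MvPolynomial.X j) * (MvPolynomial.pderiv j).toLinearMap +
          (1 : Module.End ℂ (V M)) := by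
      apply LinearMap.ext
      intro p
      simp
    rw [h1, if_pos rfl]
    cases d
    · apply TensorProduct.ext'
      intro x y
      simp [fac, TensorProduct.add_tmul]
    · apply TensorProduct.ext'
      intro x y
      simp [fac, TensorProduct.tmul_add]
  · rw [if_neg h, add_zero]
    congr 1
    apply LinearMap.ext
    intro p
    simp [MvPolynomial.pderiv_X_of_ne (Ne.symm h)]

theorem isWeyl_pos_del : IsWeyl (pos (M := M)) del where
  pos_comm c d i j := by
    by_cases h : c = d
    · subst h
      refine (fac_mul c _ _).trans (Eq.trans ?_ (fac_mul c _ _).symm)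
      exact congrArg (fac c) (LinearMap.ext fun p => mul_left_comm _ _ _)
    · exact fac_comm h _ _
  del_comm c d i j := by
    by_cases h : c = d
    · subst h
      refine (fac_mul c _ _).trans (Eq.trans ?_ (fac_mul c _ _).symm)
      exact congrArg (fac c) (pderiv_mul_pderiv i j)
    · exact fac_comm h _ _
  del_pos c d i j := by
    by_cases h : d = c
    · subst h
      refine (fac_mul d _ _).trans ((fac_pderiv_mulLeft d i j).trans ?_)
      rw [← fac_mul]
      simp only [true_and]
      rfl
    · simp only [h, false_and, if_false]
      exact (fac_comm h _ _).trans (add_zero _).symm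

/-- The operator `∑ x_i ∂_i` with `x_i` in factor `c` and `∂_i` in factor `d`. -/
def euler (M : ℕ) (c d : Bool) : Module.End ℂ (V M ⊗[ℂ] V M) := gl pos del c d

theorem op_false (i j : Fin M) : op pos del false false i j = TensorProduct.map (e M i j) 1 :=
  fac_mul false _ _

theorem op_true (i j : Fin M) : op pos del true true i j = TensorProduct.map 1 (e M i j) :=
  fac_mul true _ _

theorem map_e_e_apply (i j i' j' : Fin M) (u : V M ⊗[ℂ] V M) :
    TensorProduct.map (e M i j) (e M i' j') u =
      op pos del false false i j (op pos del true true i' j' u) := by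
  rw [op_false, op_true, ← Module.End.mul_apply, ← TensorProduct.map_mul, mul_one, one_mul]

theorem euler_comm_diagonal (c d : Bool) (i j : Fin M) :
    euler M c d * (TensorProduct.map (e M i j) 1 + TensorProduct.map 1 (e M i j)) =
      (TensorProduct.map (e M i j) 1 + TensorProduct.map 1 (e M i j)) * euler M c d := by
  have := isWeyl_pos_del.gl_comm_diagonal c d i j
  rw [op_false, op_true] at this
  exact this

theorem euler_apply (c d : Bool) (u : V M ⊗[ℂ] V M) :
    euler M c d u = ∑ x, pos c x (del d x u) := by
  rw [euler, gl]
  exact LinearMap.sum_apply _ _ _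

theorem euler_intertwining {t l m : ℂ} {u : V M ⊗[ℂ] V M}
    (hl : euler M false false u = l • u) (hm : euler M true true u = m • u)
    (c : ℕ → ℂ) (hc0 : c 0 = 1)
    (hc : ∀ s : ℕ, c (s + 1) * ((s + 1) * (l - m + s + 1 - t)) = -c s) (N : ℕ)
    (hN : (euler M false true ^ N) u = 0) (i j : Fin M) :
    ∑ s ∈ Finset.range (N + 1), c s • (euler M true false ^ s) ((euler M false true ^ s)
      ((t • TensorProduct.map (e M i j) 1 +
        ∑ x, TensorProduct.map (e M i x) (e M x j) : Module.End ℂ (V M ⊗[ℂ] V M)) u)) =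
    (t • TensorProduct.map (e M i j) 1 +
        ∑ x, TensorProduct.map (e M x j) (e M i x) : Module.End ℂ (V M ⊗[ℂ] V M))
      (∑ s ∈ Finset.range (N + 1),
        c s • (euler M true false ^ s) ((euler M false true ^ s) u)) := by
  have := isWeyl_pos_del.intertwining hl hm c hc0 hc N hN i j
  simp only [LinearMap.add_apply, LinearMap.sum_apply, LinearMap.smul_apply, map_e_e_apply,
    ← op_false]
  exact this

/-! ### The grading -/

theorem monomial_tmul_mem_VV (d d' : Fin M →₀ ℕ) :
    (MvPolynomial.monomial d (1 : ℂ)) ⊗ₜ[ℂ] (MvPolynomial.monomial d' (1 : ℂ)) ∈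
      VV M d.degree d'.degree :=
  Submodule.apply_mem_map₂ _ (MvPolynomial.isHomogeneous_monomial _ rfl)
    (MvPolynomial.isHomogeneous_monomial _ rfl)

theorem VV_le {l m : ℕ} {K : Submodule ℂ (V M ⊗[ℂ] V M)}
    (h : ∀ p q : V M, p.IsHomogeneous l → q.IsHomogeneous m → p ⊗ₜ[ℂ] q ∈ K) : VV M l m ≤ K :=
  Submodule.map₂_le.mpr fun p hp q hq => h p q hp hq

theorem VV_le_of_monomial {l m : ℕ} {K : Submodule ℂ (V M ⊗[ℂ] V M)}
    (h : ∀ d d' : Fin M →₀ ℕ, d.degree = l → d'.degree = m →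
      (MvPolynomial.monomial d (1 : ℂ)) ⊗ₜ[ℂ] (MvPolynomial.monomial d' (1 : ℂ)) ∈ K) :
    VV M l m ≤ K := by
  refine VV_le fun p q hp hq => ?_
  rw [p.as_sum, q.as_sum, TensorProduct.sum_tmul]
  refine K.sum_mem fun d hd => ?_
  rw [TensorProduct.tmul_sum]
  refine K.sum_mem fun d' hd' => ?_
  rw [← mul_one (p.coeff d), ← mul_one (q.coeff d'), ← smul_eq_mul, ← smul_eq_mul,
    ← MvPolynomial.smul_monomial, ← MvPolynomial.smul_monomial, TensorProduct.tmul_smul,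
    ← TensorProduct.smul_tmul']
  refine K.smul_mem _ (K.smul_mem _ (h d d' ?_ ?_))
  · have := hp (MvPolynomial.mem_support_iff.mp hd)
    rw [Finsupp.degree_eq_weight_one]
    exact this
  · have := hq (MvPolynomial.mem_support_iff.mp hd')
    rw [Finsupp.degree_eq_weight_one]
    exact this

theorem map_mem_VV {l m l' m' : ℕ} {T : Module.End ℂ (V M ⊗[ℂ] V M)}
    (h : ∀ p q : V M, p.IsHomogeneous l → q.IsHomogeneous m → T (p ⊗ₜ[ℂ] q) ∈ VV M l' m') :
    ∀ u ∈ VV M l m, T u ∈ VV M l' m' :=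
  VV_le (K := (VV M l' m').comap T) h

theorem euler_raise_mem {l m : ℕ} {u : V M ⊗[ℂ] V M} (hu : u ∈ VV M l m) :
    euler M false true u ∈ VV M (l + 1) (m - 1) := by
  refine map_mem_VV (fun p q hp hq => ?_) u hu
  rw [euler_apply]
  refine Submodule.sum_mem _ fun x _ => ?_
  refine Submodule.apply_mem_map₂ _ ?_ hq.pderiv
  exact add_comm l 1 ▸ (MvPolynomial.isHomogeneous_X ℂ x).mul hp

theorem euler_raise_zero {l : ℕ} {u : V M ⊗[ℂ] V M} (hu : u ∈ VV M l 0) :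
    euler M false true u = 0 := by
  refine VV_le (K := LinearMap.ker (euler M false true)) (fun p q hp hq => ?_) hu
  rw [LinearMap.mem_ker, euler_apply]
  refine Finset.sum_eq_zero fun x _ => ?_
  have hq' : MvPolynomial.pderiv x q = 0 := pderiv_eq_zero_of_isHomogeneous_zero hq x
  change (LinearMap.mulLeft ℂ (MvPolynomial.X x) p) ⊗ₜ[ℂ] (MvPolynomial.pderiv x q) = 0
  rw [hq', TensorProduct.tmul_zero]

theorem euler_lower_mem {l m : ℕ} {u : V M ⊗[ℂ] V M} (hu : u ∈ VV M l m) :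
    euler M true false u ∈ VV M (l - 1) (m + 1) := by
  refine map_mem_VV (fun p q hp hq => ?_) u hu
  rw [euler_apply]
  refine Submodule.sum_mem _ fun x _ => ?_
  refine Submodule.apply_mem_map₂ _ hp.pderiv ?_
  exact add_comm m 1 ▸ (MvPolynomial.isHomogeneous_X ℂ x).mul hq

theorem euler_false_apply {l m : ℕ} {u : V M ⊗[ℂ] V M} (hu : u ∈ VV M l m) :
    euler M false false u = (l : ℂ) • u := by
  refine VV_le (K := LinearMap.eqLocus (euler M false false) ((l : ℂ) • LinearMap.id))
    (fun p q hp hq => ?_) hu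
  rw [LinearMap.mem_eqLocus, euler_apply]
  have h : ∀ x, pos false x (del false x (p ⊗ₜ[ℂ] q)) =
    (MvPolynomial.X x * MvPolynomial.pderiv x p) ⊗ₜ[ℂ] q := fun x => rfl
  simp only [h, ← TensorProduct.sum_tmul, hp.sum_X_mul_pderiv]
  rw [← Nat.cast_smul_eq_nsmul ℂ]
  rfl

theorem euler_true_apply {l m : ℕ} {u : V M ⊗[ℂ] V M} (hu : u ∈ VV M l m) :
    euler M true true u = (m : ℂ) • u := by
  refine VV_le (K := LinearMap.eqLocus (euler M true true) ((m : ℂ) • LinearMap.id))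
    (fun p q hp hq => ?_) hu
  rw [LinearMap.mem_eqLocus, euler_apply]
  have h : ∀ x, pos true x (del true x (p ⊗ₜ[ℂ] q)) =
    p ⊗ₜ[ℂ] (MvPolynomial.X x * MvPolynomial.pderiv x q) := fun x => rfl
  simp only [h, ← TensorProduct.tmul_sum, hq.sum_X_mul_pderiv]
  rw [← Nat.cast_smul_eq_nsmul ℂ, TensorProduct.tmul_smul]
  rfl

/-! ### Stability of the bigrading -/

theorem e_isHomogeneous {l : ℕ} {p : V M} (hp : p.IsHomogeneous l) (i j : Fin M) :
    (e M i j p).IsHomogeneous l := by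
  rcases l with _ | l
  · have : MvPolynomial.pderiv j p = 0 := pderiv_eq_zero_of_isHomogeneous_zero hp j
    have h : e M i j p = 0 := by
      change MvPolynomial.X i * MvPolynomial.pderiv j p = 0
      rw [this, mul_zero]
    rw [h]
    exact MvPolynomial.isHomogeneous_zero _ _ _
  · have := (MvPolynomial.isHomogeneous_X ℂ i).mul (hp.pderiv (i := j))
    rwa [Nat.add_sub_cancel, add_comm] at this

theorem map_e_mem {l m : ℕ} {u : V M ⊗[ℂ] V M} (hu : u ∈ VV M l m) (i j i' j' : Fin M) :
    TensorProduct.map (e M i j) (e M i' j') u ∈ VV M l m :=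
  map_mem_VV (T := TensorProduct.map (e M i j) (e M i' j')) (fun _ _ hp hq =>
    Submodule.apply_mem_map₂ _ (e_isHomogeneous hp i j) (e_isHomogeneous hq i' j')) u hu

theorem map_e_one_mem {l m : ℕ} {u : V M ⊗[ℂ] V M} (hu : u ∈ VV M l m) (i j : Fin M) :
    TensorProduct.map (e M i j) 1 u ∈ VV M l m :=
  map_mem_VV (T := TensorProduct.map (e M i j) 1) (fun _ _ hp hq =>
    Submodule.apply_mem_map₂ _ (e_isHomogeneous hp i j) hq) u hu

theorem map_one_e_mem {l m : ℕ} {u : V M ⊗[ℂ] V M} (hu : u ∈ VV M l m) (i j : Fin M) :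
    TensorProduct.map 1 (e M i j) u ∈ VV M l m :=
  map_mem_VV (T := TensorProduct.map 1 (e M i j)) (fun _ _ hp hq =>
    Submodule.apply_mem_map₂ _ hp (e_isHomogeneous hq i j)) u hu

theorem euler_raise_pow_mem {l m : ℕ} {u : V M ⊗[ℂ] V M} (hu : u ∈ VV M l m) (s : ℕ) :
    (euler M false true ^ s) u ∈ VV M (l + s) (m - s) := by
  induction s with
  | zero => exact hu
  | succ s ih =>
    rw [pow_succ', Module.End.mul_apply]
    exact euler_raise_mem ih

theorem euler_lower_pow_mem {l m : ℕ} {u : V M ⊗[ℂ] V M} (hu : u ∈ VV M l m) (s : ℕ) :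
    (euler M true false ^ s) u ∈ VV M (l - s) (m + s) := by
  induction s with
  | zero => exact hu
  | succ s ih =>
    rw [pow_succ', Module.End.mul_apply]
    exact euler_lower_mem ih

theorem euler_raise_pow_eq_zero {l m s : ℕ} {u : V M ⊗[ℂ] V M} (hu : u ∈ VV M l m) (hs : m < s) :
    (euler M false true ^ s) u = 0 := by
  have h : (euler M false true ^ (m + 1)) u = 0 := by
    rw [pow_succ', Module.End.mul_apply]
    have := euler_raise_pow_mem hu m
    rw [Nat.sub_self] at this
    exact euler_raise_zero this
  obtain ⟨r, rfl⟩ := Nat.exists_eq_add_of_le (Nat.succ_le_of_lt hs)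
  rw [Nat.succ_eq_add_one, add_comm, pow_add, Module.End.mul_apply, h, map_zero]

theorem euler_pow_pow_mem {l m : ℕ} {u : V M ⊗[ℂ] V M} (hu : u ∈ VV M l m) (s : ℕ) :
    (euler M true false ^ s) ((euler M false true ^ s) u) ∈ VV M l m := by
  -- The truncated exponent m - s recovers m after lowering only for s ≤ m; beyond that the vector
  -- is zero.
  rcases le_or_gt s m with h | h
  · have := euler_lower_pow_mem (euler_raise_pow_mem hu s) s
    rwa [Nat.add_sub_cancel, Nat.sub_add_cancel h] at this
  · rw [euler_raise_pow_eq_zero hu h, map_zero]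
    exact Submodule.zero_mem _

theorem linearMap_ext_VV {W : Type*} [AddCommMonoid W] [Module ℂ W] {S T : V M ⊗[ℂ] V M →ₗ[ℂ] W}
    (h : ∀ l m, ∀ u ∈ VV M l m, S u = T u) : S = T :=
  ((MvPolynomial.basisMonomials (Fin M) ℂ).tensorProduct
    (MvPolynomial.basisMonomials (Fin M) ℂ)).ext fun d => by
      rw [Module.Basis.tensorProduct_apply]
      exact h _ _ _ (monomial_tmul_mem_VV d.1 d.2)

end Operators

/-! ### The scalar coefficients -/

/-- The coefficient of `F^s E^s` in `B(t)` on the weight space of weight `(x, y)`. -/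
def bCoeff (t x y : ℂ) (s : ℕ) : ℂ := ∏ j ∈ Finset.Icc 1 s, 1 / ((j : ℂ) * (t - x + y - j))

/-- The value of `C(t)` on the weight space of weight `(x, y)`. -/
def cCoeff (t x y : ℂ) : ℂ :=
  Complex.Gamma (t + 1) * Complex.Gamma (t - x + y) /
    (Complex.Gamma (t - x) * Complex.Gamma (t + y + 1))

theorem add_intCast_ne_zero {t : ℂ} (ht : t ∉ Set.range ((↑) : ℤ → ℂ)) (a : ℤ) : t + a ≠ 0 := by
  intro h
  exact ht ⟨-a, by push_cast; linear_combination -h⟩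

theorem bCoeff_zero (t x y : ℂ) : bCoeff t x y 0 = 1 := by simp [bCoeff]

theorem bCoeff_succ (t x y : ℂ) (s : ℕ) :
    bCoeff t x y (s + 1) = bCoeff t x y s * (1 / ((s + 1) * (t - x + y - (s + 1)))) := by
  simp [bCoeff, Finset.prod_Icc_succ_top]

theorem bCoeff_recurrence {t : ℂ} (ht : t ∉ Set.range ((↑) : ℤ → ℂ)) (l m s : ℕ) :
    bCoeff t l m (s + 1) * ((s + 1) * (l - m + s + 1 - t)) = -bCoeff t l m s := by
  have h1 : t - l + m - (s + 1) ≠ 0 := by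
    have := add_intCast_ne_zero ht (m - l - (s + 1))
    push_cast at this
    convert this using 1
    ring
  have h2 : (s + 1 : ℂ) ≠ 0 := Nat.cast_add_one_ne_zero s
  rw [bCoeff_succ]
  field_simp
  ring

/-- The rising factorial `x (x + 1) ⋯ (x + n - 1)`. -/
def rising (x : ℂ) (n : ℕ) : ℂ := ∏ i ∈ Finset.range n, (x + i)

theorem rising_succ (x : ℂ) (n : ℕ) : rising x (n + 1) = rising x n * (x + n) :=
  Finset.prod_range_succ _ _

theorem rising_ne_zero {t : ℂ} (ht : t ∉ Set.range ((↑) : ℤ → ℂ)) (a : ℤ) (n : ℕ) :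
    rising (t + a) n ≠ 0 :=
  Finset.prod_ne_zero_iff.mpr fun i _ => by
    have := add_intCast_ne_zero ht (a + i)
    push_cast at this
    rwa [← add_assoc] at this

theorem Gamma_add_nat {t : ℂ} (ht : t ∉ Set.range ((↑) : ℤ → ℂ)) (a : ℤ) (n : ℕ) :
    Complex.Gamma (t + a + n) = rising (t + a) n * Complex.Gamma (t + a) := by
  induction n with
  | zero => simp [rising]
  | succ n ih =>
    have h := add_intCast_ne_zero ht (a + n)
    push_cast at h
    rw [← add_assoc] at h
    rw [Nat.cast_succ, ← add_assoc, Complex.Gamma_add_one _ h, ih, rising_succ]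
    ring

theorem Gamma_ne_zero_of_notMem_int {t : ℂ} (ht : t ∉ Set.range ((↑) : ℤ → ℂ)) (a : ℤ) :
    Complex.Gamma (t + a) ≠ 0 :=
  Complex.Gamma_ne_zero fun m h => add_intCast_ne_zero ht (a + m) (by
    push_cast
    linear_combination h)

/-- The Gamma factors pair into quotients whose arguments differ by the natural number m. This form
shows that C(t) is rational in t with poles only at integers. -/
theorem cCoeff_eq {t : ℂ} (ht : t ∉ Set.range ((↑) : ℤ → ℂ)) (l m : ℕ) :
    cCoeff t l m = rising (t - l) m / rising (t + 1) m := by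
  have h1 := Gamma_add_nat ht (-l) m
  have h2 := Gamma_add_nat ht 1 m
  have h3 := Gamma_ne_zero_of_notMem_int ht (-l)
  have h4 := Gamma_ne_zero_of_notMem_int ht 1
  have h5 := rising_ne_zero ht 1 m
  push_cast at h1 h2 h3 h4 h5
  rw [← sub_eq_add_neg] at h1 h3
  rw [cCoeff, h1, add_right_comm t, h2]
  field_simp

/-- The Chu–Vandermonde identity for rising factorials. -/
theorem rising_add (x y : ℂ) (n : ℕ) :
    ∑ p ∈ Finset.HasAntidiagonal.antidiagonal n, (n.choose p.1 : ℂ) * (rising x p.1 * rising y p.2) =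
      rising (x + y) n := by
  induction n with
  | zero => simp [rising]
  | succ n ih =>
    rw [Finset.sum_antidiagonal_choose_succ_mul (fun i j => rising x i * rising y j),
      rising_succ (x + y), ← ih, Finset.sum_mul, ← Finset.sum_add_distrib]
    -- Pascal's rule gives each pair (p, q) with p + q = n two contributions, with new factors x + p
    -- and y + q; they add up to the last factor x + y + n on the right.
    refine Finset.sum_congr rfl fun p hp => ?_
    have h : (p.1 : ℂ) + p.2 = n := by exact_mod_cast Finset.HasAntidiagonal.mem_antidiagonal.mp hp
    have h' : n.choose p.2 = n.choose p.1 :=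
      Nat.choose_symm_of_eq_add (by rw [← Finset.HasAntidiagonal.mem_antidiagonal.mp hp, add_comm])
    rw [rising_succ, rising_succ, h', ← h]
    ring

/-- After s! clears the integer denominators, the remaining ones are precisely the top s factors of
the rising factorial. -/
theorem rising_mul_bCoeff {t : ℂ} (ht : t ∉ Set.range ((↑) : ℤ → ℂ)) (l m s : ℕ) (hs : s ≤ m) :
    rising (t - l) m * (bCoeff t l m s * s.factorial) = rising (t - l) (m - s) := by
  induction s with
  | zero => simp [bCoeff_zero]
  | succ s ih =>
    obtain ⟨r, rfl⟩ := Nat.exists_eq_add_of_le hs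
    have ih := ih (by omega)
    have h1 : s + 1 + r - s = r + 1 := by omega
    rw [h1, rising_succ] at ih
    have h2 : t - l + r ≠ 0 := by
      have := add_intCast_ne_zero ht (r - l)
      push_cast at this
      convert this using 1
      ring
    have h3 : (s + 1 : ℂ) ≠ 0 := Nat.cast_add_one_ne_zero s
    rw [bCoeff_succ, Nat.add_sub_cancel_left, Nat.factorial_succ]
    have h4 : t - l + ((s + 1 + r : ℕ) : ℂ) - (s + 1) = t - l + r := by push_cast; ring
    rw [h4]
    apply mul_right_cancel₀ h2
    rw [← ih]
    push_cast
    field_simp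

theorem descFactorial_eq_rising (l s : ℕ) : ((l + s).descFactorial s : ℂ) = rising (l + 1) s := by
  induction s with
  | zero => simp [rising]
  | succ s ih =>
    rw [← add_assoc, Nat.succ_descFactorial_succ, rising_succ, ← ih]
    push_cast
    ring

theorem sum_bCoeff {t : ℂ} (ht : t ∉ Set.range ((↑) : ℤ → ℂ)) (l m : ℕ) :
    cCoeff t l m * ∑ s ∈ Finset.range (m + 1),
      bCoeff t l m s * ((m.descFactorial s : ℂ) * ((l + s).descFactorial s : ℂ)) = 1 := by
  have h1 := rising_ne_zero ht 1 m
  push_cast at h1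
  -- The choice x = l + 1, y = t - l matches the factors coming from F^s and from B(t), and x + y =
  -- t + 1 gives the denominator of C(t).
  have h2 := rising_add (l + 1) (t - l) m
  rw [show (l : ℂ) + 1 + (t - l) = t + 1 by ring,
    Finset.Nat.sum_antidiagonal_eq_sum_range_succ
      (fun i j => (m.choose i : ℂ) * (rising (l + 1) i * rising (t - l) j))] at h2
  rw [cCoeff_eq ht, div_mul_eq_mul_div, div_eq_one_iff_eq h1, ← h2, Finset.mul_sum]
  refine Finset.sum_congr rfl fun s hs => ?_
  rw [← rising_mul_bCoeff ht l m s (by simpa [Nat.lt_succ_iff] using hs),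
    Nat.descFactorial_eq_factorial_mul_choose, descFactorial_eq_rising]
  push_cast
  ring

/-! ### The explicit R-matrix -/

variable {M : ℕ}

/-- The explicit R-matrix `B(t) C(t)` on `V_• ⊗ V_•`. -/
def rOp (M : ℕ) (t : ℂ) : Module.End ℂ (V M ⊗[ℂ] V M) :=
  ((MvPolynomial.basisMonomials (Fin M) ℂ).tensorProduct
    (MvPolynomial.basisMonomials (Fin M) ℂ)).constr ℂ fun d =>
      cCoeff t d.1.degree d.2.degree • ∑ s ∈ Finset.range (d.2.degree + 1),
        bCoeff t d.1.degree d.2.degree s • (euler M true false ^ s) ((euler M false true ^ s)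
          (MvPolynomial.monomial d.1 1 ⊗ₜ MvPolynomial.monomial d.2 1))

theorem rOp_monomial (t : ℂ) (d d' : Fin M →₀ ℕ) :
    rOp M t (MvPolynomial.monomial d 1 ⊗ₜ MvPolynomial.monomial d' 1) =
      cCoeff t d.degree d'.degree • ∑ s ∈ Finset.range (d'.degree + 1),
        bCoeff t d.degree d'.degree s • (euler M true false ^ s) ((euler M false true ^ s)
          (MvPolynomial.monomial d 1 ⊗ₜ MvPolynomial.monomial d' 1)) := by
  have h := ((MvPolynomial.basisMonomials (Fin M) ℂ).tensorProduct
    (MvPolynomial.basisMonomials (Fin M) ℂ)).constr_basis ℂ (fun d =>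
      cCoeff t d.1.degree d.2.degree • ∑ s ∈ Finset.range (d.2.degree + 1),
        bCoeff t d.1.degree d.2.degree s • (euler M true false ^ s) ((euler M false true ^ s)
          (MvPolynomial.monomial d.1 (1 : ℂ) ⊗ₜ[ℂ] MvPolynomial.monomial d.2 (1 : ℂ)))) (d, d')
  rw [Module.Basis.tensorProduct_apply] at h
  exact h

/-- E^s kills V_l ⊗ V_m for s > m, so any longer truncation gives the same operator. The free bound
N is needed later, to reach a vanishing power of E and to match the truncation of B(t). -/
theorem rOp_apply (t : ℂ) {l m : ℕ} {u : V M ⊗[ℂ] V M} (hu : u ∈ VV M l m) {N : ℕ} (hN : m ≤ N) :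
    rOp M t u = cCoeff t l m • ∑ s ∈ Finset.range (N + 1),
      bCoeff t l m s • (euler M true false ^ s) ((euler M false true ^ s) u) := by
  have h : VV M l m ≤ LinearMap.eqLocus (rOp M t) (cCoeff t l m • ∑ s ∈ Finset.range (N + 1),
      bCoeff t l m s • (euler M true false ^ s * euler M false true ^ s)) := by
    refine VV_le_of_monomial fun d d' hd hd' => ?_
    rw [LinearMap.mem_eqLocus, rOp_monomial, hd, hd', LinearMap.smul_apply, LinearMap.sum_apply]
    congr 1
    refine Finset.sum_subset (Finset.range_mono (by omega)) fun s _ hs => ?_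
    rw [euler_raise_pow_eq_zero (monomial_tmul_mem_VV d d') (by simpa [hd'] using hs), map_zero,
      smul_zero]
  have := h hu
  rw [LinearMap.mem_eqLocus, LinearMap.smul_apply, LinearMap.sum_apply] at this
  exact this

theorem rOp_mem (t : ℂ) {l m : ℕ} {u : V M ⊗[ℂ] V M} (hu : u ∈ VV M l m) :
    rOp M t u ∈ VV M l m := by
  rw [rOp_apply t hu le_rfl]
  exact Submodule.smul_mem _ _ (Submodule.sum_mem _ fun s _ =>
    Submodule.smul_mem _ _ (euler_pow_pow_mem hu s))

theorem euler_pow_diagonal (c d : Bool) (i j : Fin M) (s : ℕ) (u : V M ⊗[ℂ] V M) :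
    (euler M c d ^ s) ((TensorProduct.map (e M i j) 1 + TensorProduct.map 1 (e M i j) :
      Module.End ℂ (V M ⊗[ℂ] V M)) u) =
    (TensorProduct.map (e M i j) 1 + TensorProduct.map 1 (e M i j) :
      Module.End ℂ (V M ⊗[ℂ] V M)) ((euler M c d ^ s) u) :=
  LinearMap.congr_fun ((show Commute _ _ from euler_comm_diagonal c d i j).pow_left s).eq u

theorem rOp_diagonal (t : ℂ) (i j : Fin M) :
    rOp M t * (TensorProduct.map (e M i j) 1 + TensorProduct.map 1 (e M i j)) =
      (TensorProduct.map (e M i j) 1 + TensorProduct.map 1 (e M i j)) * rOp M t := by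
  refine linearMap_ext_VV fun l m u hu => ?_
  have hv : (TensorProduct.map (e M i j) 1 + TensorProduct.map 1 (e M i j) :
      Module.End ℂ (V M ⊗[ℂ] V M)) u ∈ VV M l m :=
    Submodule.add_mem _ (map_e_one_mem hu i j) (map_one_e_mem hu i j)
  rw [Module.End.mul_apply, Module.End.mul_apply, rOp_apply t hv le_rfl, rOp_apply t hu le_rfl,
    map_smul, map_sum]
  simp only [euler_pow_diagonal, map_smul]

theorem rOp_comm {t : ℂ} (ht : t ∉ Set.range ((↑) : ℤ → ℂ)) (i j : Fin M) :
    rOp M t * (t • TensorProduct.map (e M i j) 1 + ∑ c, TensorProduct.map (e M i c) (e M c j)) =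
      (t • TensorProduct.map (e M i j) 1 + ∑ c, TensorProduct.map (e M c j) (e M i c)) *
        rOp M t := by
  refine linearMap_ext_VV fun l m u hu => ?_
  have hv : (t • TensorProduct.map (e M i j) 1 + ∑ c, TensorProduct.map (e M i c) (e M c j) :
      Module.End ℂ (V M ⊗[ℂ] V M)) u ∈ VV M l m := by
    rw [LinearMap.add_apply, LinearMap.sum_apply]
    exact Submodule.add_mem _ (Submodule.smul_mem _ _ (map_e_one_mem hu i j))
      (Submodule.sum_mem _ fun c _ => map_e_mem hu _ _ _ _)
  -- The bound is m + 1, not m: `euler_intertwining` needs the power of E at the upper end to vanish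
  -- on u.
  rw [Module.End.mul_apply, Module.End.mul_apply, rOp_apply t hv (Nat.le_succ m),
    rOp_apply t hu (Nat.le_succ m), map_smul]
  congr 1
  exact euler_intertwining (euler_false_apply hu) (euler_true_apply hu) (bCoeff t l m)
    (bCoeff_zero _ _ _) (bCoeff_recurrence ht l m) (m + 1)
    (euler_raise_pow_eq_zero hu (Nat.lt_succ_self m)) i j

/-! ### Normalization on products of powers of one variable -/

theorem pderiv_X_pow_of_ne {x y : Fin M} (h : y ≠ x) (n : ℕ) :
    MvPolynomial.pderiv x ((MvPolynomial.X y : V M) ^ n) = 0 := by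
  rw [Derivation.leibniz_pow, MvPolynomial.pderiv_X_of_ne h, smul_zero, smul_zero]

theorem pderiv_X_pow_self (x : Fin M) (n : ℕ) :
    MvPolynomial.pderiv x ((MvPolynomial.X x : V M) ^ n) =
      (n : ℂ) • (MvPolynomial.X x : V M) ^ (n - 1) := by
  rw [Derivation.leibniz_pow, MvPolynomial.pderiv_X_self, smul_eq_mul, mul_one,
    Nat.cast_smul_eq_nsmul]

theorem euler_raise_X_pow (x : Fin M) (l m : ℕ) :
    euler M false true ((MvPolynomial.X x ^ l) ⊗ₜ[ℂ] (MvPolynomial.X x ^ m)) =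
      (m : ℂ) • ((MvPolynomial.X x ^ (l + 1)) ⊗ₜ[ℂ] (MvPolynomial.X x ^ (m - 1))) := by
  rw [euler_apply, Finset.sum_eq_single x]
  · change (MvPolynomial.X x * MvPolynomial.X x ^ l) ⊗ₜ[ℂ]
      (MvPolynomial.pderiv x (MvPolynomial.X x ^ m)) = _
    rw [pderiv_X_pow_self, TensorProduct.tmul_smul, pow_succ']
  · intro y _ hy
    change (MvPolynomial.X y * MvPolynomial.X x ^ l) ⊗ₜ[ℂ]
      (MvPolynomial.pderiv y (MvPolynomial.X x ^ m)) = 0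
    rw [pderiv_X_pow_of_ne (Ne.symm hy), TensorProduct.tmul_zero]
  · simp

theorem euler_lower_X_pow (x : Fin M) (l m : ℕ) :
    euler M true false ((MvPolynomial.X x ^ l) ⊗ₜ[ℂ] (MvPolynomial.X x ^ m)) =
      (l : ℂ) • ((MvPolynomial.X x ^ (l - 1)) ⊗ₜ[ℂ] (MvPolynomial.X x ^ (m + 1))) := by
  rw [euler_apply, Finset.sum_eq_single x]
  · change (MvPolynomial.pderiv x (MvPolynomial.X x ^ l)) ⊗ₜ[ℂ]
      (MvPolynomial.X x * MvPolynomial.X x ^ m) = _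
    rw [pderiv_X_pow_self, ← TensorProduct.smul_tmul', pow_succ']
  · intro y _ hy
    change (MvPolynomial.pderiv y (MvPolynomial.X x ^ l)) ⊗ₜ[ℂ]
      (MvPolynomial.X y * MvPolynomial.X x ^ m) = 0
    rw [pderiv_X_pow_of_ne (Ne.symm hy), TensorProduct.zero_tmul]
  · simp

theorem euler_raise_pow_X_pow (x : Fin M) (l m s : ℕ) :
    (euler M false true ^ s) ((MvPolynomial.X x ^ l) ⊗ₜ[ℂ] (MvPolynomial.X x ^ m)) =
      (m.descFactorial s : ℂ) •
        ((MvPolynomial.X x ^ (l + s)) ⊗ₜ[ℂ] (MvPolynomial.X x ^ (m - s))) := by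
  induction s with
  | zero => simp
  | succ s ih =>
    rw [pow_succ', Module.End.mul_apply, ih, map_smul, euler_raise_X_pow, smul_smul,
      Nat.descFactorial_succ, Nat.sub_sub, add_assoc]
    push_cast
    rw [mul_comm]

theorem euler_lower_pow_X_pow (x : Fin M) (l m s : ℕ) :
    (euler M true false ^ s) ((MvPolynomial.X x ^ l) ⊗ₜ[ℂ] (MvPolynomial.X x ^ m)) =
      (l.descFactorial s : ℂ) •
        ((MvPolynomial.X x ^ (l - s)) ⊗ₜ[ℂ] (MvPolynomial.X x ^ (m + s))) := by
  induction s with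
  | zero => simp
  | succ s ih =>
    rw [pow_succ', Module.End.mul_apply, ih, map_smul, euler_lower_X_pow, smul_smul,
      Nat.descFactorial_succ, Nat.sub_sub, add_assoc]
    push_cast
    rw [mul_comm]

theorem rOp_X_pow {t : ℂ} (ht : t ∉ Set.range ((↑) : ℤ → ℂ)) (x : Fin M) (l m : ℕ) :
    rOp M t ((MvPolynomial.X x ^ l) ⊗ₜ[ℂ] (MvPolynomial.X x ^ m)) =
      (MvPolynomial.X x ^ l) ⊗ₜ[ℂ] (MvPolynomial.X x ^ m) := by
  have hX : ∀ n, (MvPolynomial.X x ^ n : V M).IsHomogeneous n := fun n => by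
    have := (MvPolynomial.isHomogeneous_X ℂ x).pow n
    rwa [one_mul] at this
  have hu : (MvPolynomial.X x ^ l) ⊗ₜ[ℂ] (MvPolynomial.X x ^ m) ∈ VV M l m :=
    Submodule.apply_mem_map₂ _ (hX l) (hX m)
  have h : ∀ s ∈ Finset.range (m + 1), bCoeff t l m s • (euler M true false ^ s)
      ((euler M false true ^ s) ((MvPolynomial.X x ^ l) ⊗ₜ[ℂ] (MvPolynomial.X x ^ m))) =
      (bCoeff t l m s * ((m.descFactorial s : ℂ) * ((l + s).descFactorial s : ℂ))) •
        ((MvPolynomial.X x ^ l) ⊗ₜ[ℂ] (MvPolynomial.X x ^ m)) := by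
    intro s hs
    rw [euler_raise_pow_X_pow, map_smul, euler_lower_pow_X_pow, Nat.add_sub_cancel,
      Nat.sub_add_cancel (by simpa [Nat.lt_succ_iff] using hs), smul_smul, smul_smul,
      mul_assoc]
  rw [rOp_apply t hu le_rfl, Finset.sum_congr rfl h, ← Finset.sum_smul, smul_smul,
    sum_bCoeff ht, one_smul]

theorem rOp_isRMatrixAt [NeZero M] {t : ℂ} (ht : t ∉ Set.range ((↑) : ℤ → ℂ)) :
    IsRMatrixAt M t (rOp M t) where
  preserves _ _ _ hu := rOp_mem t hu
  invariant := rOp_diagonal t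
  comm := rOp_comm ht
  normalized := rOp_X_pow ht 0

/-! ### Uniqueness of the R-matrix -/

section Cyclic

theorem e_apply {M : ℕ} (i j : Fin M) (p : V M) :
    e M i j p = MvPolynomial.X i * MvPolynomial.pderiv j p := rfl

theorem diagonal_tmul {M : ℕ} (i j : Fin M) (p q : V M) :
    (TensorProduct.map (e M i j) 1 + TensorProduct.map 1 (e M i j) :
      Module.End ℂ (V M ⊗[ℂ] V M)) (p ⊗ₜ q) = e M i j p ⊗ₜ q + p ⊗ₜ e M i j q := rfl

variable {M : ℕ} [NeZero M]

/-- A subspace of `V_•` is everything if it contains the powers of `x_1` and is stable under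
applying `e_{i1}` to eigenvectors of `e_{11}`. -/
theorem eq_top_of_lowering {S : Submodule ℂ (V M)} (h1 : ∀ b : ℕ, MvPolynomial.X 0 ^ b ∈ S)
    (h2 : ∀ (p : V M) (κ : ℕ) (i : Fin M), e M 0 0 p = (κ : ℂ) • p → p ∈ S → e M i 0 p ∈ S) :
    S = ⊤ := by
  -- The induction keeps an arbitrary power of x_1 in reserve: e_i1 trades one x_1 for x_i, with the
  -- nonzero factor b + 1 + κ, where κ is the x_1-degree of the monomial.
  have key : ∀ (d : Fin M →₀ ℕ) (a : ℂ), (∃ κ : ℕ, MvPolynomial.X 0 *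
      MvPolynomial.pderiv 0 (MvPolynomial.monomial d a : V M) =
        (κ : ℂ) • MvPolynomial.monomial d a) ∧
      ∀ b, MvPolynomial.X 0 ^ b * MvPolynomial.monomial d a ∈ S := by
    refine MvPolynomial.induction_on_monomial (fun a => ⟨⟨0, ?_⟩, fun b => ?_⟩) ?_
    · rw [MvPolynomial.pderiv_C, mul_zero, Nat.cast_zero, zero_smul]
    · rw [mul_comm, ← MvPolynomial.smul_eq_C_mul]
      exact S.smul_mem _ (h1 b)
    · rintro p i ⟨⟨κ, hκ⟩, hp⟩
      refine ⟨?_, fun b => ?_⟩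
      · by_cases hi : i = 0
        · subst hi
          refine ⟨κ + 1, ?_⟩
          rw [MvPolynomial.smul_eq_C_mul] at hκ ⊢
          rw [MvPolynomial.pderiv_mul, MvPolynomial.pderiv_X_self]
          push_cast
          rw [map_add, map_one]
          linear_combination MvPolynomial.X 0 * hκ
        · refine ⟨κ, ?_⟩
          rw [MvPolynomial.smul_eq_C_mul] at hκ ⊢
          rw [MvPolynomial.pderiv_mul, MvPolynomial.pderiv_X_of_ne hi]
          linear_combination MvPolynomial.X i * hκ
      · rw [MvPolynomial.smul_eq_C_mul] at hκ
        have hd : MvPolynomial.pderiv 0 (MvPolynomial.X 0 ^ (b + 1) * p) =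
            MvPolynomial.C ((b + 1 + κ : ℕ) : ℂ) * (MvPolynomial.X 0 ^ b * p) := by
          rw [MvPolynomial.pderiv_mul, pderiv_X_pow_self, MvPolynomial.smul_eq_C_mul,
            Nat.add_sub_cancel]
          push_cast
          simp only [map_add, map_one]
          linear_combination MvPolynomial.X 0 ^ b * hκ
        have h3 : e M 0 0 (MvPolynomial.X 0 ^ (b + 1) * p) =
            ((b + 1 + κ : ℕ) : ℂ) • (MvPolynomial.X 0 ^ (b + 1) * p) := by
          rw [e_apply, hd, MvPolynomial.smul_eq_C_mul]
          ring
        have h4 := h2 _ _ i h3 (hp (b + 1))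
        have h5 : ((b + 1 + κ : ℕ) : ℂ) ≠ 0 := by
          rw [Nat.cast_ne_zero]
          omega
        have h6 : e M i 0 (MvPolynomial.X 0 ^ (b + 1) * p) =
            ((b + 1 + κ : ℕ) : ℂ) • (MvPolynomial.X 0 ^ b * (p * MvPolynomial.X i)) := by
          rw [e_apply, hd, MvPolynomial.smul_eq_C_mul]
          ring
        rw [h6] at h4
        exact (S.smul_mem_iff h5).mp h4
  rw [eq_top_iff]
  rintro p -
  rw [p.as_sum]
  refine S.sum_mem fun d _ => ?_
  have := (key d (p.coeff d)).2 0
  rwa [pow_zero, one_mul] at this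

/-- `V_• ⊗ V_•` is generated by the vectors `x_1^l ⊗ x_1^m` under the diagonal `gl_M` and the
evaluated Yangian generators. -/
theorem eq_top_of_yangian_stable {t : ℂ} (ht : t ∉ Set.range ((↑) : ℤ → ℂ))
    {K : Submodule ℂ (V M ⊗[ℂ] V M)}
    (hX : ∀ l m : ℕ, (MvPolynomial.X 0 ^ l) ⊗ₜ[ℂ] (MvPolynomial.X 0 ^ m) ∈ K)
    (hD : ∀ i j : Fin M, ∀ u ∈ K, (TensorProduct.map (e M i j) 1 + TensorProduct.map 1 (e M i j) :
      Module.End ℂ (V M ⊗[ℂ] V M)) u ∈ K)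
    (hA : ∀ i j : Fin M, ∀ u ∈ K, (t • TensorProduct.map (e M i j) 1 +
      ∑ c, TensorProduct.map (e M i c) (e M c j) : Module.End ℂ (V M ⊗[ℂ] V M)) u ∈ K) :
    K = ⊤ := by
  have hright : ∀ (l : ℕ) (w : V M), (MvPolynomial.X 0 ^ l) ⊗ₜ[ℂ] w ∈ K := by
    suffices h : (⨅ l : ℕ, K.comap (TensorProduct.mk ℂ (V M) (V M) (MvPolynomial.X 0 ^ l))) = ⊤ by
      intro l w
      have hw : w ∈ (⊤ : Submodule ℂ (V M)) := trivial
      rw [← h, Submodule.mem_iInf] at hw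
      exact hw l
    refine eq_top_of_lowering (fun b => ?_) fun w κ i hκ hw => ?_
    · exact (Submodule.mem_iInf _).mpr fun l => hX l b
    · refine (Submodule.mem_iInf _).mpr fun l => ?_
      have hw : (MvPolynomial.X 0 ^ l) ⊗ₜ[ℂ] w ∈ K := (Submodule.mem_iInf _).mp hw l
      have h1 := hA i 0 _ hw
      -- Only c = 0 survives, since the first factor involves x_1 alone. The result is a pure tensor
      -- with scalar t + κ, nonzero because t is not an integer, so the two terms of the diagonal
      -- action can be separated.
      have h2 : (t • TensorProduct.map (e M i 0) 1 +
          ∑ c, TensorProduct.map (e M i c) (e M c 0) : Module.End ℂ (V M ⊗[ℂ] V M))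
            ((MvPolynomial.X 0 ^ l) ⊗ₜ[ℂ] w) =
          (t + (κ : ℤ)) • (e M i 0 (MvPolynomial.X 0 ^ l) ⊗ₜ[ℂ] w) := by
        rw [LinearMap.add_apply, LinearMap.sum_apply, Finset.sum_eq_single 0]
        · rw [LinearMap.smul_apply, TensorProduct.map_tmul, TensorProduct.map_tmul, hκ,
            TensorProduct.tmul_smul, add_smul, Int.cast_natCast]
          rfl
        · intro c _ hc
          rw [TensorProduct.map_tmul, e_apply i c, pderiv_X_pow_of_ne (Ne.symm hc), mul_zero,
            TensorProduct.zero_tmul]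
        · simp
      rw [h2, K.smul_mem_iff (add_intCast_ne_zero ht κ)] at h1
      have h3 := hD i 0 _ hw
      rw [diagonal_tmul] at h3
      exact (K.add_mem_iff_right h1).mp h3
  have hleft : ∀ p w : V M, p ⊗ₜ[ℂ] w ∈ K := by
    -- All w are treated at once: then p ⊗ e_i1 w is already in K, and the diagonal action alone
    -- yields e_i1 p ⊗ w.
    suffices h : (⨅ w : V M, K.comap ((TensorProduct.mk ℂ (V M) (V M)).flip w)) = ⊤ by
      intro p w
      have hp : p ∈ (⊤ : Submodule ℂ (V M)) := trivial
      rw [← h, Submodule.mem_iInf] at hp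
      exact hp w
    refine eq_top_of_lowering (fun b => ?_) fun p κ i _ hp => ?_
    · exact (Submodule.mem_iInf _).mpr fun w => hright b w
    · refine (Submodule.mem_iInf _).mpr fun w => ?_
      have hp : ∀ w, p ⊗ₜ[ℂ] w ∈ K := (Submodule.mem_iInf _).mp hp
      have h3 := hD i 0 _ (hp w)
      rw [diagonal_tmul] at h3
      exact (K.add_mem_iff_left (hp (e M i 0 w))).mp h3
  rw [eq_top_iff, ← TensorProduct.span_tmul_eq_top, Submodule.span_le]
  rintro _ ⟨p, w, rfl⟩
  exact hleft p w

theorem IsRMatrixAt.eq {t : ℂ} (ht : t ∉ Set.range ((↑) : ℤ → ℂ))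
    {S T : Module.End ℂ (V M ⊗[ℂ] V M)} (hS : IsRMatrixAt M t S) (hT : IsRMatrixAt M t T) :
    S = T := by
  -- An operator intertwined with the same A' by both S and T preserves the locus where they agree.
  have h : ∀ A A' : Module.End ℂ (V M ⊗[ℂ] V M), S * A = A' * S → T * A = A' * T →
      ∀ u ∈ LinearMap.eqLocus S T, A u ∈ LinearMap.eqLocus S T := by
    intro A A' h1 h2 u hu
    rw [LinearMap.mem_eqLocus] at hu ⊢
    rw [← Module.End.mul_apply, ← Module.End.mul_apply, h1, h2, Module.End.mul_apply,
      Module.End.mul_apply, hu]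
  have htop : LinearMap.eqLocus S T = ⊤ := by
    refine eq_top_of_yangian_stable ht (fun l m => ?_)
      (fun i j => h _ _ (hS.invariant i j) (hT.invariant i j))
      (fun i j => h _ _ (hS.comm i j) (hT.comm i j))
    rw [LinearMap.mem_eqLocus, hS.normalized, hT.normalized]
  exact LinearMap.eqLocus_eq_top.mp htop

end Cyclic

/-! ### Rational dependence on the parameter -/

section Rational

variable {W : Type*} [AddCommMonoid W] [Module ℂ W]

/-- A vector-valued polynomial function. -/
def IsPolyFun (f : ℂ → W) : Prop := ∃ F : ℕ →₀ W, ∀ t, f t = F.sum fun i w => t ^ i • w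

theorem IsPolyFun.add {f g : ℂ → W} (hf : IsPolyFun f) (hg : IsPolyFun g) :
    IsPolyFun fun t => f t + g t := by
  obtain ⟨F, hF⟩ := hf
  obtain ⟨G, hG⟩ := hg
  refine ⟨F + G, fun t => ?_⟩
  beta_reduce
  rw [Finsupp.sum_add_index' (fun _ => smul_zero _) (fun _ _ _ => smul_add _ _ _), hF, hG]

theorem IsPolyFun.pow_smul {f : ℂ → W} (hf : IsPolyFun f) (j : ℕ) :
    IsPolyFun fun t => t ^ j • f t := by
  obtain ⟨F, hF⟩ := hf
  refine ⟨F.mapDomain (j + ·), fun t => ?_⟩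
  beta_reduce
  rw [Finsupp.sum_mapDomain_index (fun _ => smul_zero _) (fun _ _ _ => smul_add _ _ _), hF,
    Finsupp.smul_sum]
  simp only [pow_add, mul_smul]

theorem IsPolyFun.const_smul {f : ℂ → W} (hf : IsPolyFun f) (a : ℂ) :
    IsPolyFun fun t => a • f t := by
  obtain ⟨F, hF⟩ := hf
  refine ⟨F.mapRange (a • ·) (smul_zero _), fun t => ?_⟩
  beta_reduce
  rw [Finsupp.sum_mapRange_index (fun _ => smul_zero _), hF, Finsupp.smul_sum]
  exact Finset.sum_congr rfl fun _ _ => smul_comm _ _ _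

theorem isPolyFun_const (w : W) : IsPolyFun fun _ => w :=
  ⟨Finsupp.single 0 w, fun t => by simp⟩

theorem IsPolyFun.poly_smul {f : ℂ → W} (hf : IsPolyFun f) (p : Polynomial ℂ) :
    IsPolyFun fun t => p.eval t • f t := by
  induction p using Polynomial.induction_on' with
  | add p q hp hq =>
    simp only [Polynomial.eval_add, add_smul]
    exact hp.add hq
  | monomial n a =>
    simp only [Polynomial.eval_monomial, mul_smul]
    exact (hf.pow_smul n).const_smul a

theorem IsPolyFun.exists_range {f : ℂ → W} (hf : IsPolyFun f) :
    ∃ (N : ℕ) (w : ℕ → W), ∀ t, f t = ∑ i ∈ Finset.range N, t ^ i • w i := by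
  obtain ⟨F, hF⟩ := hf
  obtain ⟨N, hN⟩ := F.support.exists_nat_subset_range
  exact ⟨N, F, fun t => by rw [hF, Finsupp.sum_of_support_subset F hN _ fun _ _ => smul_zero _]⟩

/-- A vector-valued function that is rational on `ℂ ∖ ℤ`. -/
def IsRatFun (f : ℂ → W) : Prop := ∃ q : Polynomial ℂ, q ≠ 0 ∧ ∃ g : ℂ → W, IsPolyFun g ∧
  ∀ t : ℂ, t ∉ Set.range ((↑) : ℤ → ℂ) → q.eval t • f t = g t

theorem IsRatFun.add {f g : ℂ → W} (hf : IsRatFun f) (hg : IsRatFun g) :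
    IsRatFun fun t => f t + g t := by
  obtain ⟨q, hq, F, hF, h⟩ := hf
  obtain ⟨r, hr, G, hG, h'⟩ := hg
  refine ⟨q * r, mul_ne_zero hq hr, _, (hF.poly_smul r).add (hG.poly_smul q), fun t ht => ?_⟩
  rw [← h t ht, ← h' t ht, Polynomial.eval_mul, smul_add, mul_comm, mul_smul, mul_comm, mul_smul]

theorem IsRatFun.const_smul {f : ℂ → W} (hf : IsRatFun f) (a : ℂ) :
    IsRatFun fun t => a • f t := by
  obtain ⟨q, hq, F, hF, h⟩ := hf
  exact ⟨q, hq, _, hF.const_smul a, fun t ht => by rw [← h t ht, smul_comm]⟩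

theorem isRatFun_const (w : W) : IsRatFun fun _ => w :=
  ⟨1, one_ne_zero, _, isPolyFun_const w, fun t _ => by rw [Polynomial.eval_one, one_smul]⟩

theorem IsRatFun.sum {ι : Type*} (s : Finset ι) {f : ι → ℂ → W} (hf : ∀ i, IsRatFun (f i)) :
    IsRatFun fun t => ∑ i ∈ s, f i t := by
  classical
  induction s using Finset.induction_on with
  | empty => simpa using isRatFun_const (0 : W)
  | insert i s hi ih =>
    simp only [Finset.sum_insert hi]
    exact (hf i).add ih

theorem IsRatFun.congr {f g : ℂ → W} (hf : IsRatFun f)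
    (h : ∀ t : ℂ, t ∉ Set.range ((↑) : ℤ → ℂ) → g t = f t) : IsRatFun g := by
  obtain ⟨q, hq, F, hF, h'⟩ := hf
  exact ⟨q, hq, F, hF, fun t ht => by rw [h t ht, h' t ht]⟩

/-- A scalar function that is a quotient of polynomials on `ℂ ∖ ℤ`. -/
def IsRatScalar (g : ℂ → ℂ) : Prop := ∃ p q : Polynomial ℂ, q ≠ 0 ∧
  ∀ t : ℂ, t ∉ Set.range ((↑) : ℤ → ℂ) → q.eval t * g t = p.eval t

theorem IsRatScalar.mul {f g : ℂ → ℂ} (hf : IsRatScalar f) (hg : IsRatScalar g) :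
    IsRatScalar fun t => f t * g t := by
  obtain ⟨p, q, hq, h⟩ := hf
  obtain ⟨p', q', hq', h'⟩ := hg
  refine ⟨p * p', q * q', mul_ne_zero hq hq', fun t ht => ?_⟩
  rw [Polynomial.eval_mul, Polynomial.eval_mul, ← h t ht, ← h' t ht]
  ring

theorem isRatScalar_const (a : ℂ) : IsRatScalar fun _ => a :=
  ⟨Polynomial.C a, 1, one_ne_zero, fun t _ => by simp⟩

theorem IsRatScalar.prod {ι : Type*} (s : Finset ι) {f : ι → ℂ → ℂ} (hf : ∀ i, IsRatScalar (f i)) :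
    IsRatScalar fun t => ∏ i ∈ s, f i t := by
  classical
  induction s using Finset.induction_on with
  | empty => simpa using isRatScalar_const 1
  | insert i s hi ih =>
    simp only [Finset.prod_insert hi]
    exact (hf i).mul ih

theorem isRatScalar_add (a : ℂ) : IsRatScalar fun t => t + a :=
  ⟨Polynomial.X + Polynomial.C a, 1, one_ne_zero, fun t _ => by simp⟩

theorem isRatScalar_inv (a : ℤ) : IsRatScalar fun t => (t + a)⁻¹ :=
  ⟨1, Polynomial.X + Polynomial.C (a : ℂ), Polynomial.X_add_C_ne_zero _, fun t ht => by
    simpa using mul_inv_cancel₀ (add_intCast_ne_zero ht a)⟩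

theorem IsRatScalar.smul {g : ℂ → ℂ} (hg : IsRatScalar g) {f : ℂ → W} (hf : IsRatFun f) :
    IsRatFun fun t => g t • f t := by
  obtain ⟨p, q, hq, h⟩ := hg
  obtain ⟨r, hr, F, hF, h'⟩ := hf
  refine ⟨q * r, mul_ne_zero hq hr, _, hF.poly_smul p, fun t ht => ?_⟩
  rw [← h' t ht, ← h t ht, Polynomial.eval_mul, smul_smul, smul_smul]
  congr 1
  ring

theorem isRatScalar_bCoeff (l m s : ℕ) : IsRatScalar fun t => bCoeff t l m s := by
  refine IsRatScalar.prod _ fun j => ?_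
  have h := (isRatScalar_const (j : ℂ)⁻¹).mul (isRatScalar_inv (m - l - j))
  convert h using 2 with t
  push_cast
  rw [one_div, mul_inv]
  congr 2
  ring

theorem isRatFun_cCoeff_smul (l m : ℕ) {f : ℂ → W} (hf : IsRatFun f) :
    IsRatFun fun t => cCoeff t l m • f t := by
  have h : IsRatScalar fun t => ∏ i ∈ Finset.range m, (t + (i - l)) * (t + (1 + i : ℤ))⁻¹ :=
    IsRatScalar.prod _ fun i => (isRatScalar_add _).mul (isRatScalar_inv _)
  refine (h.smul hf).congr fun t ht => ?_
  rw [cCoeff_eq ht, rising, rising, div_eq_mul_inv, ← Finset.prod_inv_distrib,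
    ← Finset.prod_mul_distrib]
  congr 1
  refine Finset.prod_congr rfl fun i _ => ?_
  push_cast
  rw [← add_assoc]
  congr 1
  ring

end Rational

theorem isRatFun_rOp {M : ℕ} (u : V M ⊗[ℂ] V M) : IsRatFun fun t => rOp M t u := by
  let B := (MvPolynomial.basisMonomials (Fin M) ℂ).tensorProduct
    (MvPolynomial.basisMonomials (Fin M) ℂ)
  have hu : u ∈ Submodule.span ℂ (Set.range B) := B.mem_span u
  induction hu using Submodule.span_induction with
  | mem v hv =>
    obtain ⟨d, rfl⟩ := hv
    have hB : B d = MvPolynomial.monomial d.1 1 ⊗ₜ[ℂ] MvPolynomial.monomial d.2 1 :=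
      Module.Basis.tensorProduct_apply' _ _ _
    rw [hB]
    simp only [rOp_monomial]
    exact isRatFun_cCoeff_smul _ _ (IsRatFun.sum _ fun s =>
      (isRatScalar_bCoeff _ _ _).smul (isRatFun_const _))
  | zero => simpa using isRatFun_const (0 : V M ⊗[ℂ] V M)
  | add v w _ _ hv hw =>
    simp only [map_add]
    exact hv.add hw
  | smul a v _ hv =>
    simp only [map_smul]
    exact hv.const_smul a

theorem rOp_isRMatrix (M : ℕ) [NeZero M] : IsRMatrix M (rOp M) where
  rational u := by
    obtain ⟨q, hq, g, hg, h⟩ := isRatFun_rOp u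
    obtain ⟨N, w, hw⟩ := hg.exists_range
    exact ⟨q, hq, N, w, fun t ht => by rw [h t ht, hw]⟩
  at_value _ ht := rOp_isRMatrixAt ht

/-! ### Existence and uniqueness for the chosen R-matrix -/

theorem rMatrix_isRMatrix (M : ℕ) [NeZero M] : IsRMatrix M (rMatrix M) := by
  have h : ∃ R, IsRMatrix M R := ⟨_, rOp_isRMatrix M⟩
  rw [rMatrix, dif_pos h]
  exact h.choose_spec

theorem IsRMatrixAt.eq_rMatrix {M : ℕ} [NeZero M] {t : ℂ} (ht : t ∉ Set.range ((↑) : ℤ → ℂ))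
    {T : Module.End ℂ (V M ⊗[ℂ] V M)} (hT : IsRMatrixAt M t T) : T = rMatrix M t :=
  hT.eq ht ((rMatrix_isRMatrix M).at_value t ht)

/-! ### Functoriality of operators acting in two tensor factors -/

section TensorPower

variable {ι : Type} [DecidableEq ι] {W : Type} [AddCommGroup W] [Module ℂ W] {i j : ι}

/-- `place` forgets the entries of p at i and j, so the formula on pure tensors extends to all w;
this makes `pairAct` multiplicative. -/
theorem pairAct_place (hij : i ≠ j) (T : Module.End ℂ (W ⊗[ℂ] W)) (p : ι → W) (w : W ⊗[ℂ] W) :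
    pairAct hij T (place hij p w) = place hij p (T w) := by
  induction w using TensorProduct.induction_on with
  | zero => simp
  | tmul u v =>
    rw [place_tmul, pairAct_tprod, place_update_right, place_update_left]
    simp [hij]
  | add u v hu hv => simp only [map_add, hu, hv]

theorem pairAct_mul (hij : i ≠ j) (S T : Module.End ℂ (W ⊗[ℂ] W)) :
    pairAct hij (S * T) = pairAct hij S * pairAct hij T := by
  apply PiTensorProduct.ext
  ext p
  simp only [LinearMap.compMultilinearMap_apply, Module.End.mul_apply, pairAct_tprod,
    pairAct_place]

theorem pairAct_sum {κ : Type} (hij : i ≠ j) (s : Finset κ) (T : κ → Module.End ℂ (W ⊗[ℂ] W)) :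
    pairAct hij (∑ x ∈ s, T x) = ∑ x ∈ s, pairAct hij (T x) := by
  apply PiTensorProduct.ext
  ext p
  simp only [LinearMap.compMultilinearMap_apply, LinearMap.sum_apply, pairAct_tprod, map_sum]

theorem pairAct_pow (hij : i ≠ j) (T : Module.End ℂ (W ⊗[ℂ] W)) (s : ℕ) :
    pairAct hij (T ^ s) = pairAct hij T ^ s := by
  induction s with
  | zero =>
    apply PiTensorProduct.ext
    ext p
    simp [pairAct_tprod, place_tmul]
  | succ s ih => rw [pow_succ, pow_succ, pairAct_mul, ih]

theorem pairAct_map_left (hij : i ≠ j) (S : Module.End ℂ W) (p : ι → W) :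
    pairAct hij (TensorProduct.map S 1) (PiTensorProduct.tprod ℂ p) =
      PiTensorProduct.tprod ℂ (Function.update p i (S (p i))) := by
  rw [pairAct_tprod, TensorProduct.map_tmul, place_tmul, Function.update_comm hij]
  simp

theorem pairAct_map_right (hij : i ≠ j) (S : Module.End ℂ W) (p : ι → W) :
    pairAct hij (TensorProduct.map 1 S) (PiTensorProduct.tprod ℂ p) =
      PiTensorProduct.tprod ℂ (Function.update p j (S (p j))) := by
  rw [pairAct_tprod, TensorProduct.map_tmul, place_tmul]
  simp

end TensorPower

/-! ### Differential operators on a tensor power of polynomial rings -/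

section Transfer

variable {α β γ : Type}

theorem pderiv_rename_of_ne (φ : α × β ≃ γ) {a b : α} (hab : a ≠ b) (x : β)
    (p : MvPolynomial β ℂ) :
    MvPolynomial.pderiv (φ (b, x)) (MvPolynomial.rename (fun y => φ (a, y)) p) = 0 := by
  induction p using MvPolynomial.induction_on with
  | C c => simp
  | add p q hp hq => simp only [map_add, hp, hq, add_zero]
  | mul_X p y hp =>
    have h : φ (a, y) ≠ φ (b, x) := fun h => hab (congrArg Prod.fst (φ.injective h))
    rw [map_mul, MvPolynomial.pderiv_mul, hp, MvPolynomial.rename_X,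
      MvPolynomial.pderiv_X_of_ne h, zero_mul, mul_zero, add_zero]

theorem pderiv_prod_rename [DecidableEq α] (φ : α × β ≃ γ) (b : α) (x : β) (p : α → MvPolynomial β ℂ)
    (s : Finset α) (hs : b ∉ s) :
    MvPolynomial.pderiv (φ (b, x))
      (∏ i ∈ s, MvPolynomial.rename (fun y => φ (i, y)) (p i)) = 0 := by
  induction s using Finset.induction_on with
  | empty => simp
  | insert i s hi ih =>
    rw [Finset.mem_insert, not_or] at hs
    rw [Finset.prod_insert hi, MvPolynomial.pderiv_mul, ih hs.2,
      pderiv_rename_of_ne φ (Ne.symm hs.1), zero_mul, mul_zero, add_zero]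

variable [Fintype α]

theorem prodMap_monomial (φ : α × β ≃ γ) (d : α → β →₀ ℕ) :
    ∃ D : γ →₀ ℕ, prodMap φ (PiTensorProduct.tprod ℂ fun i => MvPolynomial.monomial (d i) 1) =
      MvPolynomial.monomial D 1 ∧ ∀ i x, D (φ (i, x)) = d i x := by
  refine ⟨∑ i, Finsupp.mapDomain (fun x => φ (i, x)) (d i), ?_, fun i x => ?_⟩
  · rw [prodMap_tprod]
    simp only [MvPolynomial.rename_monomial]
    exact (MvPolynomial.monomial_sum_one _ _).symm
  · rw [Finsupp.finsetSum_apply, Finset.sum_eq_single i]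
    · exact Finsupp.mapDomain_apply (f := fun x => φ (i, x))
        (fun y z h => by simpa using h) (d i) x
    · intro j _ hj
      apply Finsupp.mapDomain_of_notMem_range
      rintro ⟨y, hy⟩
      exact hj (congrArg Prod.fst (φ.injective hy))
    · simp

variable [DecidableEq α]

theorem prodMap_update (φ : α × β ≃ γ) (p : α → MvPolynomial β ℂ) (a : α) (q : MvPolynomial β ℂ) :
    prodMap φ (PiTensorProduct.tprod ℂ (Function.update p a q)) =
      MvPolynomial.rename (fun x => φ (a, x)) q *
        ∏ i ∈ Finset.univ.erase a, MvPolynomial.rename (fun x => φ (i, x)) (p i) := by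
  rw [prodMap_tprod, ← Finset.mul_prod_erase Finset.univ _ (Finset.mem_univ a),
    Function.update_self]
  congr 1
  refine Finset.prod_congr rfl fun i hi => ?_
  rw [Function.update_of_ne (Finset.ne_of_mem_erase hi)]

theorem prodMap_eq_mul (φ : α × β ≃ γ) (p : α → MvPolynomial β ℂ) (a : α) :
    prodMap φ (PiTensorProduct.tprod ℂ p) =
      MvPolynomial.rename (fun x => φ (a, x)) (p a) *
        ∏ i ∈ Finset.univ.erase a, MvPolynomial.rename (fun x => φ (i, x)) (p i) := by
  rw [← prodMap_update, Function.update_eq_self]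

theorem prodMap_update_X_mul (φ : α × β ≃ γ) (p : α → MvPolynomial β ℂ) (a : α) (x : β) :
    prodMap φ (PiTensorProduct.tprod ℂ (Function.update p a (MvPolynomial.X x * p a))) =
      MvPolynomial.X (φ (a, x)) * prodMap φ (PiTensorProduct.tprod ℂ p) := by
  rw [prodMap_update, prodMap_eq_mul φ p a, map_mul, MvPolynomial.rename_X, mul_assoc]

theorem prodMap_update_pderiv (φ : α × β ≃ γ) (p : α → MvPolynomial β ℂ) (a : α) (x : β) :
    prodMap φ (PiTensorProduct.tprod ℂ (Function.update p a (MvPolynomial.pderiv x (p a)))) =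
      MvPolynomial.pderiv (φ (a, x)) (prodMap φ (PiTensorProduct.tprod ℂ p)) := by
  rw [prodMap_update, prodMap_eq_mul φ p a, MvPolynomial.pderiv_mul, MvPolynomial.pderiv_rename (fun _ _ h => congrArg Prod.snd (φ.injective h)),
    pderiv_prod_rename φ a x p _ (Finset.notMem_erase a _), mul_zero, add_zero]

variable {M : ℕ} (φ : α × Fin M ≃ γ) {a b : α} (hab : a ≠ b)

/-- Together with `prodMap_pairAct_del` this transfers the Weyl algebra generators, hence everything
built from E and F. The flag false selects the factor a and true the factor b. -/
theorem prodMap_pairAct_pos (c : Bool) (x : Fin M) :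
    prodMap φ ∘ₗ pairAct hab (pos c x) =
      LinearMap.mulLeft ℂ (MvPolynomial.X (φ (bif c then b else a, x))) ∘ₗ prodMap φ := by
  apply PiTensorProduct.ext
  ext1 p
  cases c
  · exact (congrArg (prodMap φ) (pairAct_map_left hab _ p)).trans (prodMap_update_X_mul φ p a x)
  · exact (congrArg (prodMap φ) (pairAct_map_right hab _ p)).trans (prodMap_update_X_mul φ p b x)

theorem prodMap_pairAct_del (c : Bool) (x : Fin M) :
    prodMap φ ∘ₗ pairAct hab (del c x) =
      (MvPolynomial.pderiv (φ (bif c then b else a, x))).toLinearMap ∘ₗ prodMap φ := by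
  apply PiTensorProduct.ext
  ext1 p
  cases c
  · exact (congrArg (prodMap φ) (pairAct_map_left hab _ p)).trans (prodMap_update_pderiv φ p a x)
  · exact (congrArg (prodMap φ) (pairAct_map_right hab _ p)).trans (prodMap_update_pderiv φ p b x)

theorem prodMap_pairAct_euler (c d : Bool) (u : ⨂[ℂ] _ : α, V M) :
    prodMap φ (pairAct hab (euler M c d) u) =
      (∑ x, xd (φ (bif c then b else a, x)) (φ (bif d then b else a, x))) (prodMap φ u) := by
  have h1 := fun c x u => LinearMap.congr_fun (prodMap_pairAct_pos φ hab c x) u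
  have h2 := fun c x u => LinearMap.congr_fun (prodMap_pairAct_del φ hab c x) u
  simp only [LinearMap.comp_apply] at h1 h2
  have h : euler M c d = ∑ x, pos c x * del d x := rfl
  rw [h, pairAct_sum, LinearMap.sum_apply, LinearMap.sum_apply, map_sum]
  refine Finset.sum_congr rfl fun x _ => ?_
  rw [pairAct_mul, Module.End.mul_apply, h1, h2]
  rfl

theorem prodMap_pairAct_euler_pow (c d : Bool) (s : ℕ) (u : ⨂[ℂ] _ : α, V M) :
    prodMap φ ((pairAct hab (euler M c d) ^ s) u) =
      ((∑ x, xd (φ (bif c then b else a, x)) (φ (bif d then b else a, x))) ^ s)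
        (prodMap φ u) := by
  induction s with
  | zero => rfl
  | succ s ih =>
    rw [pow_succ', Module.End.mul_apply, prodMap_pairAct_euler, ih, pow_succ', Module.End.mul_apply]

/-- The explicit R-matrix acting in two factors, as a differential operator. -/
theorem prodMap_pairAct_rOp (t : ℂ) (d : α → Fin M →₀ ℕ) {N : ℕ} (hN : (d b).degree ≤ N) :
    prodMap φ (pairAct hab (rOp M t)
        (PiTensorProduct.tprod ℂ fun i => MvPolynomial.monomial (d i) 1)) =
      cCoeff t (d a).degree (d b).degree • ∑ s ∈ Finset.range (N + 1),
        bCoeff t (d a).degree (d b).degree s • ((∑ x, xd (φ (b, x)) (φ (a, x))) ^ s)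
          (((∑ x, xd (φ (a, x)) (φ (b, x))) ^ s)
            (prodMap φ (PiTensorProduct.tprod ℂ fun i => MvPolynomial.monomial (d i) 1))) := by
  rw [pairAct_tprod, rOp_apply t (monomial_tmul_mem_VV (d a) (d b)) hN, map_smul, map_smul, map_sum,
    map_sum]
  congr 1
  refine Finset.sum_congr rfl fun s _ => ?_
  rw [map_smul, map_smul]
  congr 1
  rw [← Module.End.mul_apply, ← pairAct_tprod, pairAct_mul, pairAct_pow, pairAct_pow,
    Module.End.mul_apply, prodMap_pairAct_euler_pow, prodMap_pairAct_euler_pow]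
  rfl

end Transfer

/-! ### The duality -/

theorem one_add_series_apply {γ : Type} {T : ℕ → Module.End ℂ (MvPolynomial γ ℂ)}
    (hT : ∀ p, ∃ N, ∀ s, N ≤ s → T (s + 1) p = 0) {p : MvPolynomial γ ℂ} (h0 : T 0 p = p) {N : ℕ}
    (hN : ∀ s, N < s → T s p = 0) :
    (1 + series (fun s => T (s + 1)) hT) p = ∑ s ∈ Finset.range (N + 1), T s p := by
  rw [Finset.sum_range_succ', h0, add_comm, LinearMap.add_apply]
  congr 1
  change ∑ᶠ s, T (s + 1) p = _
  refine finsum_eq_sum_of_support_subset _ fun s hs => ?_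
  by_contra h
  exact hs (hN (s + 1) (by simpa [Nat.lt_succ_iff] using h))

theorem linearMap_ext_monomial {α β : Type} [Fintype α] {W : Type*} [AddCommMonoid W] [Module ℂ W]
    {S T : (⨂[ℂ] _ : α, MvPolynomial β ℂ) →ₗ[ℂ] W}
    (h : ∀ d : α → β →₀ ℕ, S (PiTensorProduct.tprod ℂ fun i => MvPolynomial.monomial (d i) 1) =
      T (PiTensorProduct.tprod ℂ fun i => MvPolynomial.monomial (d i) 1)) : S = T := by
  apply (Basis.piTensorProduct (fun _ : α => MvPolynomial.basisMonomials β ℂ)).ext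
  intro d
  rw [Basis.piTensorProduct_apply]
  exact h d

theorem eq_conj_of_intertwines {W P : Type*} [AddCommMonoid W] [Module ℂ W] [AddCommMonoid P]
    [Module ℂ P] (f : W ≃ₗ[ℂ] P) {A : Module.End ℂ W} {B : Module.End ℂ P}
    (h : B ∘ₗ f.toLinearMap = f.toLinearMap ∘ₗ A) : B = f.conj A := by
  apply LinearMap.ext
  intro p
  obtain ⟨u, rfl⟩ := f.surjective p
  rw [LinearEquiv.conj_apply_apply, f.symm_apply_apply]
  exact LinearMap.congr_fun h u

/-- On monomials the degrees of factors a and b are the eigenvalues of e_aa and e_bb, and E, F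
become e_ab, e_ba of `gl_k`; uniqueness permits replacing the chosen R-matrix by `rOp`.
`Rk_eq_Bn_mul_Cn` is the same argument with rows and columns exchanged. -/
theorem Bk_mul_Ck (k n : ℕ) [NeZero n] {a b : Fin k} (hab : a ≠ b) {t : ℂ}
    (ht : t ∉ Set.range ((↑) : ℤ → ℂ)) : Bk k n hab t * Ck k n a b t = Rn k n hab t := by
  refine eq_conj_of_intertwines _ (linearMap_ext_monomial fun d => ?_)
  rw [← (rOp_isRMatrixAt ht).eq_rMatrix ht]
  obtain ⟨D, hD, hd⟩ := prodMap_monomial (Equiv.refl (Fin k × Fin n)) d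
  have hdeg : ∀ i, ((d i).degree : ℂ) = ∑ x, (D (i, x) : ℂ) := fun i => by
    rw [Finsupp.degree_eq_sum]
    push_cast
    exact Finset.sum_congr rfl fun x _ => by rw [← hd i x]; rfl
  change Bk k n hab t (Ck k n a b t (prodMap _ _)) = prodMap _ (pairAct hab (rOp n t) _)
  obtain ⟨N, hN⟩ := BkTerm_finite k n hab t (MvPolynomial.monomial D 1)
  have hC : Ck k n a b t (MvPolynomial.monomial D 1) =
      cCoeff t (d a).degree (d b).degree • MvPolynomial.monomial D 1 := by
    rw [Ck, funk, diag_monomial, hdeg, hdeg]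
    rfl
  have hT : ∀ s, BkTerm k n a b t s (MvPolynomial.monomial D 1) =
      bCoeff t (d a).degree (d b).degree s •
        (ek k n b a ^ s) ((ek k n a b ^ s) (MvPolynomial.monomial D 1)) := by
    intro s
    rw [BkTerm, Module.End.mul_apply, Module.End.mul_apply, funk, diag_monomial, hdeg, hdeg,
      map_smul, map_smul]
    rfl
  -- The common truncation is the maximum of the bound for the series B(t) and the degree of factor
  -- b, so both sides become the same finite sum.
  rw [prodMap_pairAct_rOp _ hab t d (le_max_right N (d b).degree), hD, hC, map_smul, Bk,
    one_add_series_apply _ (by simp [hT, bCoeff_zero])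
      (fun s hs => hN s ((le_max_left N (d b).degree).trans hs.le))]
  congr 1
  exact Finset.sum_congr rfl fun s _ => hT s

theorem Rk_eq_Bn_mul_Cn (k n : ℕ) [NeZero k] {i j : Fin n} (hij : i ≠ j) {t : ℂ}
    (ht : t ∉ Set.range ((↑) : ℤ → ℂ)) : Rk k n hij t = Bn k n hij t * Cn k n i j t := by
  refine (eq_conj_of_intertwines _ (linearMap_ext_monomial fun d => ?_)).symm
  rw [← (rOp_isRMatrixAt ht).eq_rMatrix ht]
  obtain ⟨D, hD, hd⟩ := prodMap_monomial (Equiv.prodComm (Fin n) (Fin k)) d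
  have hdeg : ∀ i, ((d i).degree : ℂ) = ∑ x, (D (x, i) : ℂ) := fun i => by
    rw [Finsupp.degree_eq_sum]
    push_cast
    exact Finset.sum_congr rfl fun x _ => by rw [← hd i x]; rfl
  change Bn k n hij t (Cn k n i j t (prodMap _ _)) = prodMap _ (pairAct hij (rOp k t) _)
  obtain ⟨N, hN⟩ := BnTerm_finite k n hij t (MvPolynomial.monomial D 1)
  have hC : Cn k n i j t (MvPolynomial.monomial D 1) =
      cCoeff t (d i).degree (d j).degree • MvPolynomial.monomial D 1 := by
    rw [Cn, funn, diag_monomial, hdeg, hdeg]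
    rfl
  have hT : ∀ s, BnTerm k n i j t s (MvPolynomial.monomial D 1) =
      bCoeff t (d i).degree (d j).degree s •
        (en k n j i ^ s) ((en k n i j ^ s) (MvPolynomial.monomial D 1)) := by
    intro s
    rw [BnTerm, Module.End.mul_apply, Module.End.mul_apply, funn, diag_monomial, hdeg, hdeg,
      map_smul, map_smul]
    rfl
  rw [prodMap_pairAct_rOp _ hij t d (le_max_right N (d j).degree), hD, hC, map_smul, Bn,
    one_add_series_apply _ (by simp [hT, bCoeff_zero])
      (fun s hs => hN s ((le_max_left N (d j).degree).trans hs.le))]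
  congr 1
  exact Finset.sum_congr rfl fun s _ => hT s

end GLDuality

end

theorem theorem5p9 (k n : ℕ) [NeZero k] [NeZero n] :
    (GLDuality.IsRMatrix n (GLDuality.rMatrix n) ∧ ∀ (t : ℂ), t ∉ Set.range ((↑) : ℤ → ℂ) →
      ∀ T, GLDuality.IsRMatrixAt n t T → T = GLDuality.rMatrix n t) ∧
    (GLDuality.IsRMatrix k (GLDuality.rMatrix k) ∧ ∀ (t : ℂ), t ∉ Set.range ((↑) : ℤ → ℂ) →
      ∀ T, GLDuality.IsRMatrixAt k t T → T = GLDuality.rMatrix k t) ∧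
    (∀ (a b : Fin k) (hab : a ≠ b) (t : ℂ), t ∉ Set.range ((↑) : ℤ → ℂ) →
      GLDuality.Bk k n hab t * GLDuality.Ck k n a b t = GLDuality.Rn k n hab t) ∧
    (∀ (i j : Fin n) (hij : i ≠ j) (t : ℂ), t ∉ Set.range ((↑) : ℤ → ℂ) →
      GLDuality.Rk k n hij t = GLDuality.Bn k n hij t * GLDuality.Cn k n i j t) := by
  refine ⟨⟨GLDuality.rMatrix_isRMatrix n, fun t ht T hT => hT.eq_rMatrix ht⟩,
    ⟨GLDuality.rMatrix_isRMatrix k, fun t ht T hT => hT.eq_rMatrix ht⟩,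
    fun a b hab t ht => GLDuality.Bk_mul_Ck k n hab ht,
    fun i j hij t ht => GLDuality.Rk_eq_Bn_mul_Cn k n hij ht⟩
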